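/- Conventions. For $u\in\mathfrak S_n$, let $\ell(u)$ be its number of inversions, let $s_i=(i\ i+1)$, and for $1\le i\le n-1$ let $\tau_i(u)=us_i$ if $\ell(us_i)>\ell(u)$ and $\tau_i(u)=u$ otherwise (so $\tau_i$ puts the entries in positions $i,i+1$ in decreasing order). For a word $\mathbf w=(i_1,\dots,i_r)$ let $\tau_{\mathbf w}=\tau_{i_r}\circ\cdots\circ\tau_{i_1}$. A permuton is a probability measure on $[0,1]^2$ with uniform marginals; $\pi_u$ is the permuton with constant density $n$ on each square $\{(x,y): i-1\le nx\le i,\ u(i)-1\le ny\le u(i)\}$, $1\le i\le n$, and density $0$ elsewhere. A Coxeter word over $[n-1]=\{1,\dots,n-1\}$ is a word using each letter exactly once. Two words are commutation equivalent if one is obtained from the other by repeatedly swapping adjacent letters that differ by at least $2$. For $n\ge2$, let $\Lambda$ be a lattice path of $n$ unit east and south steps that starts at $(0,0)$, begins with a south step and ends with an east step, and let $\Lambda'$ be obtained from $\Lambda$ by changing the first step to an east step and the last step to a south step. A Coxeter word $\mathbf c$ corresponds to $\Lambda$ if it is commutation equivalent to a word listing the contents $x-y\in[n-1]$ of the unit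 boxes with lower-left vertex $(x,y)\in\mathbb Z^2$ between $\Lambda$ and $\Lambda'$, the boxes being listed along a linear extension of the order $(x,y)\le(x',y')\iff x\le x'$ and $y\le y'$. Let $\theta_\Lambda\colon[0,1]\to\mathbb R$ be the function such that the scaled path $\frac1n\Lambda$ is the curve $z\mapsto(\theta_\Lambda(z),\theta_\Lambda(z)-z)$. For $\alpha>0$ and $\beta\in[0,1]$, with $\alpha/0=\infty$, let $$\mathscr U_{\searrow}=\Big\{(x,y)\in\big[\tfrac{\alpha}{1-\beta},1\big]\times\big[0,\min\{1-\beta,1-\tfrac{\alpha}{1-\beta}\}\big]: y\le 1-\tfrac{\alpha}{(1-\beta)(1-x)+\alpha}\Big\},$$ $$\mathscr U_{\nwarrow}=\Big\{(x,y)\in\big[0,1-\tfrac{\alpha}{\beta}\big]\times\big[\max\{1-\beta,\tfrac{\alpha}{\beta}\},1\big]: y\ge \tfrac{\alpha}{\beta x+\alpha}\Big\},$$ $$J_{\searrow}=\big\{x:\max\{\tfrac{\alpha}{1-\beta},1-\tfrac{\alpha}{\beta}\}\le x\le1\big\},\quad J_{\nwarrow}=\big\{x:0\le x\le\min\{\tfrac{\alpha}{1-\beta},1-\tfrac{\alpha}{\beta}\}\big\},\quad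 J=\big\{x\in[0,1]:1-\tfrac{\alpha}{\beta}\le x\le\tfrac{\alpha}{1-\beta}\big\},$$ and let $\nu^{\alpha,\beta}$ be the measure given, for measurable $A\subseteq[0,1]^2$, by $$\nu^{\alpha,\beta}(A)=\iint_{A\cap(\mathscr U_\searrow\cup\mathscr U_\nwarrow)}\!dx\,dy+\int_{J_\searrow}\mathbf 1_A\Big(x,1-\tfrac{\alpha}{(1-\beta)(1-x)+\alpha}\Big)\tfrac{\alpha}{(1-\beta)(1-x)+\alpha}\,dx+\int_{J_\nwarrow}\mathbf 1_A\Big(x,\tfrac{\alpha}{\beta x+\alpha}\Big)\tfrac{\alpha}{\beta x+\alpha}\,dx+\int_J\mathbf 1_A(x,1-x)\,dx .$$ **Theorem.** Fix $\alpha>0$ and $\beta\in[0,1]$. Then $\nu^{\alpha,\beta}$ is a permuton. Let $(v_n)_{n\ge1}$ be random permutations defined on a common probability space, with $v_n$ uniformly distributed on $\mathfrak S_n$. For each $n\ge2$ let $\mathbf c_n$ be a Coxeter word over $[n-1]$ corresponding to a lattice path $\Lambda^{(n)}$, and suppose that $\theta_{\Lambda^{(n)}}(z)\to\beta z$ for every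 $z\in[0,1]$. Then, almost surely, the permutons of $u_n=\tau_{\mathbf c_n}^{\lfloor\alpha n\rfloor}(v_n)$ converge weakly to $\nu^{\alpha,\beta}$. In particular, almost surely, the permutons of $\tau_{(1,2,\dots,n-1)}^{\lfloor\alpha n\rfloor}(v_n)$ (the iterated bubble-sort map) converge weakly to $\nu^{\alpha,1}$. -/

import Mathlib

open MeasureTheory Filter Topology
open scoped ENNReal

namespace BubbleSort

/-! ### Permutons -/

/-- A measure on the plane is a permuton if it is a probability measure carried by `[0,1]²`
whose two marginals are uniform. -/
structure IsPermuton (μ : Measure (ℝ × ℝ)) : Prop where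
  isProbabilityMeasure : IsProbabilityMeasure μ
  support_subset : μ (Set.Icc (0 : ℝ) 1 ×ˢ Set.Icc (0 : ℝ) 1)ᶜ = 0
  horizontal : ∀ a b : ℝ, 0 ≤ a → a ≤ b → b ≤ 1 →
    μ (Set.Icc a b ×ˢ Set.Icc (0 : ℝ) 1) = ENNReal.ofReal (b - a)
  vertical : ∀ a b : ℝ, 0 ≤ a → a ≤ b → b ≤ 1 →
    μ (Set.Icc (0 : ℝ) 1 ×ˢ Set.Icc a b) = ENNReal.ofReal (b - a)

/-- The square of side `1/n` attached to the point of the plot of `u` in position `i`.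
Positions and values are numbered `0, …, n-1` by `Fin n`, so this is
`{(x, y) : i ≤ n x ≤ i + 1, u i ≤ n y ≤ u i + 1}`. -/
def plotSquare {n : ℕ} (u : Equiv.Perm (Fin n)) (i : Fin n) : Set (ℝ × ℝ) :=
  Set.Icc ((i : ℕ) / n : ℝ) (((i : ℕ) + 1) / n) ×ˢ
    Set.Icc ((u i : ℕ) / n : ℝ) (((u i : ℕ) + 1) / n)

/-- The measure with constant density `n` on each of the squares of the plot of `u`. -/
noncomputable def permMeasure {n : ℕ} (u : Equiv.Perm (Fin n)) : Measure (ℝ × ℝ) :=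
  ∑ i : Fin n, (n : ℝ≥0∞) • volume.restrict (plotSquare u i)

theorem isProbabilityMeasure_permMeasure (n : ℕ+) (u : Equiv.Perm (Fin n)) :
    IsProbabilityMeasure (permMeasure u) := by
  constructor
  have hn : (0 : ℝ) < (n : ℕ) := by exact_mod_cast n.pos
  have h : ∀ i : Fin n, volume (plotSquare u i) = ENNReal.ofReal (1 / ((n : ℕ) : ℝ) ^ 2) := by
    intro i
    rw [plotSquare, Measure.volume_eq_prod, Measure.prod_prod, Real.volume_Icc, Real.volume_Icc,
      ← ENNReal.ofReal_mul (by rw [← sub_div]; ring_nf; positivity)]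
    congr 1
    field_simp
    ring
  simp only [permMeasure, Measure.coe_finsetSum, Finset.sum_apply, Measure.smul_apply,
    Measure.restrict_apply_univ, h, smul_eq_mul, Finset.sum_const, Finset.card_univ,
    Fintype.card_fin, nsmul_eq_mul]
  rw [← ENNReal.ofReal_natCast, ← ENNReal.ofReal_mul hn.le, ← ENNReal.ofReal_mul hn.le]
  rw [← ENNReal.ofReal_one]
  congr 1
  field_simp

/-- The permuton `π_u` of a permutation `u`, as a probability measure on the plane. -/
noncomputable def permPermuton (n : ℕ+) (u : Equiv.Perm (Fin n)) : ProbabilityMeasure (ℝ × ℝ) :=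
  ⟨permMeasure u, isProbabilityMeasure_permMeasure n u⟩

/-! ### The operators `τ` -/

/-- The number of inversions of `v`: pairs `a < b` with `v⁻¹ a > v⁻¹ b`. -/
def inversions {n : ℕ} (v : Equiv.Perm (Fin n)) : ℕ :=
  (Finset.univ.filter fun p : Fin n × Fin n => p.1 < p.2 ∧ v⁻¹ p.2 < v⁻¹ p.1).card

/-- The simple transposition `s_i = (i i+1)` for `1 ≤ i ≤ n - 1`; the points `i`, `i + 1` of
`{1, …, n}` are the elements `i - 1`, `i` of `Fin n`. The identity for other values of `i`. -/
def simpleTransposition (n i : ℕ) : Equiv.Perm (Fin n) :=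
  if h : 1 ≤ i ∧ i < n then
    Equiv.swap ⟨i - 1, lt_of_le_of_lt (Nat.sub_le i 1) h.2⟩ ⟨i, h.2⟩
  else 1

/-- `τ_i(u)` is `u s_i` if this has more inversions than `u`, and `u` otherwise. -/
def tau {n : ℕ} (i : ℕ) (u : Equiv.Perm (Fin n)) : Equiv.Perm (Fin n) :=
  if inversions u < inversions (u * simpleTransposition n i) then u * simpleTransposition n i
  else u

/-- `τ_w = τ_{i_r} ∘ ⋯ ∘ τ_{i_1}` for the word `w = (i_1, …, i_r)`. -/
def tauWord {n : ℕ} (w : List ℕ) (u : Equiv.Perm (Fin n)) : Equiv.Perm (Fin n) :=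
  w.foldl (fun v i => tau i v) u

/-! ### Words -/

/-- A Coxeter word over `{1, …, n - 1}` uses each letter exactly once. -/
def IsCoxeterWord (n : ℕ) (w : List ℕ) : Prop :=
  w.Nodup ∧ ∀ i, i ∈ w ↔ 1 ≤ i ∧ i < n

/-- A commutation move swaps two adjacent letters whose values differ by at least `2`. -/
def CommMove (w w' : List ℕ) : Prop :=
  ∃ (p q : List ℕ) (i j : ℕ), (i + 2 ≤ j ∨ j + 2 ≤ i) ∧ w = p ++ i :: j :: q ∧
    w' = p ++ j :: i :: q

/-- Commutation equivalence of words. -/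
def CommEquiv : List ℕ → List ℕ → Prop := Relation.ReflTransGen CommMove

/-! ### Lattice paths and shapes -/

/-- The two kinds of unit steps of a lattice path. -/
inductive Dir : Type
  | east : Dir
  | south : Dir

/-- A lattice path that starts on the line `x - y = 0`, at the point `(start, start)`, and uses
`n` unit east and south steps (each of which increases `x - y` by one), hence ends on the line
`x - y = n`. -/
structure LatticePath (n : ℕ) where
  start : ℤ
  steps : Fin n → Dir

namespace LatticePath

variable {n : ℕ}

open Classical in
/-- The abscissa of the vertex reached after `k` steps, that is, of the vertex of the path on the
line `x - y = k`. -/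
noncomputable def xCoord (L : LatticePath n) (k : ℕ) : ℤ :=
  L.start + (Finset.univ.filter fun j : Fin n => (j : ℕ) < k ∧ L.steps j = Dir.east).card

/-- The function `θ` on `[0,1]` such that the path scaled by `1/n` is the curve
`z ↦ (θ z, θ z - z)`: since `(θ z, θ z - z)` lies on the line `x - y = z`, the number `n θ z` is
the abscissa of the point of the path on the line `x - y = n z`, found by linear interpolation
between consecutive vertices. -/
noncomputable def theta (L : LatticePath n) (z : ℝ) : ℝ :=
  ((L.xCoord ⌊n * z⌋₊ : ℝ) +
    (n * z - ⌊n * z⌋₊) * ((L.xCoord (⌊n * z⌋₊ + 1) : ℝ) - (L.xCoord ⌊n * z⌋₊ : ℝ))) / n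

open Classical in
/-- The path obtained by changing the first step to an east step and the last step to a south
step. -/
noncomputable def flipEnds (L : LatticePath n) : LatticePath n where
  start := L.start
  steps j := if (j : ℕ) = 0 then Dir.east else if (j : ℕ) + 1 = n then Dir.south else L.steps j

end LatticePath

/-- A box is given by its lower-left vertex `(x, y)`; its content is `x - y`. -/
def content (b : ℤ × ℤ) : ℤ := b.1 - b.2

/-- The order-convex shape between a southwest path `L` and a northeast path `M`: a unit box of
content `i`, `1 ≤ i ≤ n - 1`, has its lower-left and upper-right vertices `(x, y)` and
`(x + 1, y + 1)` on the line `x - y = i`, and lies between the paths when the former is weakly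
northeast of `L` and the latter is weakly southwest of `M`. -/
def shape {n : ℕ} (L M : LatticePath n) : Set (ℤ × ℤ) :=
  {b | ∃ i : ℕ, 1 ≤ i ∧ i < n ∧ content b = i ∧ L.xCoord i ≤ b.1 ∧ b.1 + 1 ≤ M.xCoord i}

/-- `l` lists the boxes of `S` along a linear extension of the order
`(x, y) ≤ (x', y') ↔ x ≤ x' ∧ y ≤ y'`. -/
def IsLinearExtension (S : Set (ℤ × ℤ)) (l : List (ℤ × ℤ)) : Prop :=
  l.Nodup ∧ (∀ b, b ∈ l ↔ b ∈ S) ∧ l.Pairwise fun b b' => ¬ b' ≤ b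

/-- The Coxeter word `w` over `{1, …, n - 1}` corresponds to the lattice path `L`: the path starts
at `(0, 0)`, begins with a south step, ends with an east step, and `w` is, up to commutation
equivalence, the word of contents of the one-layer shape whose southwest boundary is `L`. -/
structure Corresponds {n : ℕ} (w : List ℕ) (L : LatticePath n) : Prop where
  coxeter : IsCoxeterWord n w
  start_eq : L.start = 0
  first_step : ∀ j : Fin n, (j : ℕ) = 0 → L.steps j = Dir.south
  last_step : ∀ j : Fin n, (j : ℕ) + 1 = n → L.steps j = Dir.east
  word : ∃ l : List (ℤ × ℤ), IsLinearExtension (shape L L.flipEnds) l ∧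
    CommEquiv w (l.map fun b => (content b).toNat)

/-! ### The limit measure

The thresholds `α / (1 - β)` and `α / β` are read as `∞` when the denominator vanishes. For
`β ∈ [0,1]` and `α > 0` the inequalities between them and real numbers are written with the
denominators cleared, which is correct in that case as well:
`α / (1 - β) ≤ x ↔ α ≤ (1 - β) x` and `x ≤ 1 - α / β ↔ α ≤ β (1 - x)`. -/

/-- `{(x, y) : α/(1-β) ≤ x ≤ 1, 0 ≤ y ≤ min (1-β) (1 - α/(1-β)), y ≤ 1 - α/((1-β)(1-x)+α)}`. -/
def regionSE (α β : ℝ) : Set (ℝ × ℝ) :=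
  {p | α ≤ (1 - β) * p.1 ∧ p.1 ≤ 1 ∧ 0 ≤ p.2 ∧ p.2 ≤ 1 - β ∧ α ≤ (1 - β) * (1 - p.2) ∧
    p.2 ≤ 1 - α / ((1 - β) * (1 - p.1) + α)}

/-- `{(x, y) : 0 ≤ x ≤ 1 - α/β, max (1-β) (α/β) ≤ y ≤ 1, α/(βx+α) ≤ y}`. -/
def regionNW (α β : ℝ) : Set (ℝ × ℝ) :=
  {p | 0 ≤ p.1 ∧ α ≤ β * (1 - p.1) ∧ 1 - β ≤ p.2 ∧ α ≤ β * p.2 ∧ p.2 ≤ 1 ∧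
    α / (β * p.1 + α) ≤ p.2}

/-- `{x : max (α/(1-β)) (1 - α/β) ≤ x ≤ 1}`, the abscissas of the southeast arc. -/
def arcSE (α β : ℝ) : Set ℝ := {x | α ≤ (1 - β) * x ∧ β * (1 - x) ≤ α ∧ x ≤ 1}

/-- `{x : 0 ≤ x ≤ min (α/(1-β)) (1 - α/β)}`, the abscissas of the northwest arc. -/
def arcNW (α β : ℝ) : Set ℝ := {x | 0 ≤ x ∧ (1 - β) * x ≤ α ∧ α ≤ β * (1 - x)}

/-- `{x ∈ [0,1] : 1 - α/β ≤ x ≤ α/(1-β)}`, the abscissas of the anti-diagonal segment. -/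
def segment (α β : ℝ) : Set ℝ := {x | 0 ≤ x ∧ x ≤ 1 ∧ β * (1 - x) ≤ α ∧ (1 - β) * x ≤ α}

/-- The measure `ν^{α,β}`: Lebesgue measure on the two regions, plus the measure
`α/((1-β)(1-x)+α) dx` on the arc `y = 1 - α/((1-β)(1-x)+α)`, plus the measure `α/(βx+α) dx` on the
arc `y = α/(βx+α)`, plus the measure `dx` on the segment of the anti-diagonal `y = 1 - x`. -/
noncomputable def nu (α β : ℝ) : Measure (ℝ × ℝ) :=
  volume.restrict (regionSE α β ∪ regionNW α β)
    + Measure.map (fun x : ℝ => (x, 1 - α / ((1 - β) * (1 - x) + α)))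
        ((volume.restrict (arcSE α β)).withDensity
          fun x => ENNReal.ofReal (α / ((1 - β) * (1 - x) + α)))
    + Measure.map (fun x : ℝ => (x, α / (β * x + α)))
        ((volume.restrict (arcNW α β)).withDensity fun x => ENNReal.ofReal (α / (β * x + α)))
    + Measure.map (fun x : ℝ => (x, 1 - x)) (volume.restrict (segment α β))

/-! ### Random permutations -/

/-- The random permutation `v`, defined on the probability space `(Ω, P)`, is uniformly
distributed. -/
def IsUniformPerm {Ω : Type*} [MeasurableSpace Ω] (P : Measure Ω) {n : ℕ}
    (v : Ω → Equiv.Perm (Fin n)) : Prop :=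
  ∀ σ : Equiv.Perm (Fin n), MeasurableSet (v ⁻¹' {σ}) ∧ P (v ⁻¹' {σ}) = (n.factorial : ℝ≥0∞)⁻¹

end BubbleSort

/-! Fix `m` and let h(k) count the entries among the `m` smallest values in the first k positions.
Sorting positions i, i+1 into decreasing order replaces h(i) by max(h(i-1), h(i+1)-1) and changes
nothing else (`profile_tau`). The evolution of the permutation thus splits into scalar recursions,
one for each `m`.

The step of the lattice path from content i to i+1 decides which of the letters i, i+1 comes first
in the word. Let x_i be the abscissa of the path at content i, and attach the value h_t(i) after t
rounds to the lattice point (x_i + t, x_i - i + t). The recursion becomes a last-passage problem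
with deterministic weights: arriving from the west neighbour costs 0, from the south neighbour 1.
All monotone routes between two given points cost the same, so h_t(i) is the maximum of h_0(j) +
(x_j - j) - (x_i - i) - t over the reachable points j of the initial path, unless it equals one of
the trivial bounds 0 and i + h(n) - n coming from the two boundary lines (`IsEvolution.lower`,
`IsEvolution.upper`).

For a uniform permutation h_0(j) is close to yj when `m` is close to yn, and x_j is close to βj by
assumption. In the limit an affine function of w = j/n is maximised over an interval, which gives
F(z,y) = max(0, z+y-1, zy - α min(y/(1-β), (1-y)/β)) (`tendsto_evolution`). Randomness enters only
through a uniform law of large numbers for corner counts, proved by a Chernoff bound and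
Borel-Cantelli (`ae_eventually_cornerCount`); the joint law of the permutations plays no role.

It remains to recognise F as the distribution function of ν (`nu_Iic_prod_Iic`). On a vertical line,
∂F/∂z is 0, y or 1 according to which of the three terms is largest, and this is exactly the
conditional distribution function of ν on that line. Then F(a,1) = F(1,a) = a makes ν a permuton,
and pointwise convergence of distribution functions gives weak convergence
(`tendsto_of_tendsto_Iic_prod_Iic`). -/

namespace BubbleSort

/-! ### Corner counts and the sorting operators -/

section Discrete

variable {n : ℕ}

/-- The number of points of the plot of `u` among the first `k` positions and the `m` smallest
values. -/
def cornerCount (u : Equiv.Perm (Fin n)) (m k : ℕ) : ℕ :=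
  (Finset.univ.filter fun p : Fin n => (p : ℕ) < k ∧ (u p : ℕ) < m).card

theorem cornerCount_zero (u : Equiv.Perm (Fin n)) (m : ℕ) : cornerCount u m 0 = 0 := by
  simp [cornerCount]

theorem cornerCount_succ (u : Equiv.Perm (Fin n)) (m : ℕ) (p : Fin n) :
    cornerCount u m (p + 1) = cornerCount u m p + if (u p : ℕ) < m then 1 else 0 := by
  have h : (Finset.univ.filter fun r : Fin n => (r : ℕ) < p + 1 ∧ (u r : ℕ) < m) =
      (Finset.univ.filter fun r : Fin n => (r : ℕ) < p ∧ (u r : ℕ) < m) ∪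
        (Finset.univ.filter fun r : Fin n => r = p ∧ (u r : ℕ) < m) := by
    ext r
    simp only [Finset.mem_filter, Finset.mem_univ, true_and, Finset.mem_union, Fin.ext_iff]
    omega
  rw [cornerCount, h, Finset.card_union_of_disjoint, cornerCount]
  · congr 1
    split_ifs with hp
    · rw [Finset.card_eq_one]
      refine ⟨p, ?_⟩
      ext r
      simp only [Finset.mem_filter, Finset.mem_univ, true_and, Finset.mem_singleton]
      exact ⟨fun h => h.1, fun h => ⟨h, h ▸ hp⟩⟩
    · rw [Finset.card_eq_zero, Finset.filter_eq_empty_iff]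
      rintro r - ⟨rfl, hr⟩
      exact hp hr
  · rw [Finset.disjoint_filter]
    rintro r - h1 ⟨rfl, -⟩
    omega

theorem cornerCount_mono (u : Equiv.Perm (Fin n)) (m : ℕ) : Monotone (cornerCount u m) := by
  intro k l h
  refine Finset.card_le_card fun p => ?_
  simp only [Finset.mem_filter, Finset.mem_univ, true_and]
  omega

theorem cornerCount_succ_le (u : Equiv.Perm (Fin n)) (m k : ℕ) :
    cornerCount u m (k + 1) ≤ cornerCount u m k + 1 := by
  by_cases h : k < n
  · have := cornerCount_succ u m ⟨k, h⟩
    simp only at this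
    split_ifs at this <;> omega
  · refine le_trans (Finset.card_le_card fun p => ?_) (Nat.le_succ _)
    simp only [Finset.mem_filter, Finset.mem_univ, true_and]
    have := p.2
    omega

theorem cornerCount_symm (u : Equiv.Perm (Fin n)) (m k : ℕ) :
    cornerCount u⁻¹ m k = cornerCount u k m := by
  refine Finset.card_equiv u⁻¹ fun p => ?_
  simp [and_comm]

theorem cornerCount_add_one_add_one_le (u : Equiv.Perm (Fin n)) (m k : ℕ) :
    cornerCount u (m + 1) (k + 1) ≤ cornerCount u m k + 2 := by
  have h1 := cornerCount_succ_le u (m + 1) k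
  have h2 := cornerCount_succ_le u⁻¹ k m
  rw [cornerCount_symm, cornerCount_symm] at h2
  omega

theorem cornerCount_full_left (u : Equiv.Perm (Fin n)) {k : ℕ} (hk : k ≤ n) :
    cornerCount u n k = k := by
  have : (Finset.univ.filter fun p : Fin n => (p : ℕ) < k ∧ (u p : ℕ) < n) =
      Finset.univ.filter fun p : Fin n => (p : ℕ) < k := by
    ext p; simp
  rw [cornerCount, this, Fin.card_filter_val_lt, min_eq_right hk]

theorem cornerCount_full_right (u : Equiv.Perm (Fin n)) {m : ℕ} (hm : m ≤ n) :
    cornerCount u m n = m := by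
  rw [← cornerCount_symm, cornerCount_full_left _ hm]

theorem swap_lt_swap {p q x y : Fin n} (hpq : (q : ℕ) = p + 1) (hxy : x < y)
    (h : ¬ (x = p ∧ y = q)) : Equiv.swap p q x < Equiv.swap p q y := by
  rw [Equiv.swap_apply_def, Equiv.swap_apply_def]
  simp only [Fin.ext_iff, Fin.lt_def] at *
  split_ifs <;> omega

/-- Inversions are recorded as pairs of values, and an adjacent swap of positions only affects the
relative order of the two values moved. The old inversion set is therefore contained in the new one,
which also has the pair (u p, u q). -/
theorem inversions_lt_mul_swap (u : Equiv.Perm (Fin n)) {p q : Fin n} (hpq : (q : ℕ) = p + 1)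
    (h : u p < u q) : inversions u < inversions (u * Equiv.swap p q) := by
  refine Finset.card_lt_card ((Finset.ssubset_iff_of_subset ?_).2 ⟨(u p, u q), ?_, ?_⟩)
  · rintro ⟨a, b⟩
    simp only [Finset.mem_filter, Finset.mem_univ, true_and, mul_inv_rev, Equiv.swap_inv,
      Equiv.Perm.mul_apply]
    rintro ⟨hab, hba⟩
    refine ⟨hab, swap_lt_swap hpq hba ?_⟩
    rintro ⟨rfl, rfl⟩
    rw [← Equiv.Perm.mul_apply, ← Equiv.Perm.mul_apply, mul_inv_cancel, Equiv.Perm.one_apply,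
      Equiv.Perm.one_apply] at h
    exact lt_asymm h hab
  · have hlt : p < q := Fin.lt_def.2 (by omega)
    simp [h, hlt]
  · have hlt : p < q := Fin.lt_def.2 (by omega)
    simp [hlt.le]

theorem tau_apply (u : Equiv.Perm (Fin n)) {p q : Fin n} (hpq : (q : ℕ) = p + 1) :
    tau (q : ℕ) u = if u p < u q then u * Equiv.swap p q else u := by
  have hs : simpleTransposition n q = Equiv.swap p q := by
    rw [simpleTransposition, dif_pos ⟨by omega, q.2⟩]
    congr 1
    ext
    simp [hpq]
  rw [tau, hs]
  split_ifs with h1 h2 h2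
  · rfl
  · exfalso
    -- Otherwise the swap would create a descent removal that increases length; swapping back
    -- contradicts `inversions_lt_mul_swap`.
    have h3 : u q < u p := lt_of_le_of_ne (not_lt.1 h2) fun h => by
      have := congrArg Fin.val (u.injective h)
      omega
    have := inversions_lt_mul_swap (u * Equiv.swap p q) hpq (by simpa using h3)
    rw [mul_assoc, Equiv.swap_mul_self, mul_one] at this
    exact lt_asymm h1 this
  · exact absurd (inversions_lt_mul_swap u hpq h2) h1
  · rfl

theorem cornerCount_mul_swap (u : Equiv.Perm (Fin n)) {p q : Fin n} (hpq : (q : ℕ) = p + 1)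
    (m : ℕ) {k : ℕ} (hk : k ≠ q) :
    cornerCount (u * Equiv.swap p q) m k = cornerCount u m k := by
  refine Finset.card_equiv (Equiv.swap p q) fun r => ?_
  rw [Finset.mem_filter_univ, Finset.mem_filter_univ]
  refine and_congr_left fun _ => ?_
  rw [Equiv.swap_apply_def]
  simp only [Fin.ext_iff]
  split_ifs <;> omega

/-- The number of points of `u` among the first `k` positions and the `m` smallest values, as an
integer-valued function of `k`. -/
def profile (u : Equiv.Perm (Fin n)) (m : ℕ) : ℕ → ℤ := fun k => cornerCount u m k

/-- The effect of `τ_i` on a profile. -/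
def relax (f : ℕ → ℤ) (i : ℕ) : ℕ → ℤ :=
  Function.update f i (max (f (i - 1)) (f (i + 1) - 1))

/-- In decreasing order a small entry comes second, so the count at i exceeds the count at i-1 only
when both entries are small, that is, when the count grows by 2 from i-1 to i+1. The maximum encodes
this. Prefixes of any other length contain both positions or neither, or only miss them altogether,
and keep their count. -/
theorem profile_tau (u : Equiv.Perm (Fin n)) (m : ℕ) {i : ℕ} (h1 : 1 ≤ i) (h2 : i < n) :
    profile (tau i u) m = relax (profile u m) i := by
  obtain ⟨p, q, hpq, rfl⟩ : ∃ p q : Fin n, (q : ℕ) = p + 1 ∧ (q : ℕ) = i :=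
    ⟨⟨i - 1, by omega⟩, ⟨i, h2⟩, by simp; omega, rfl⟩
  rw [tau_apply u hpq]
  funext k
  have e1 := cornerCount_succ u m p
  have e2 := cornerCount_succ u m q
  have e3 := cornerCount_succ (u * Equiv.swap p q) m p
  have e4 := cornerCount_mul_swap u hpq m (k := p) (by omega)
  rw [← hpq] at e1 e3
  simp only [Equiv.Perm.mul_apply, Equiv.swap_apply_left] at e3
  have e5 : (q : ℕ) - 1 = p := by omega
  by_cases hk : k = q
  · subst hk
    simp only [relax, Function.update_self, profile, e5]
    split_ifs with h
    · simp only [Fin.lt_def] at h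
      split_ifs at e1 e2 e3 <;> omega
    · simp only [Fin.lt_def] at h
      split_ifs at e1 e2 e3 <;> omega
  · rw [relax, Function.update_of_ne hk]
    split_ifs with h
    · simp only [profile, cornerCount_mul_swap u hpq m hk]
    · rfl

theorem profile_tauWord (u : Equiv.Perm (Fin n)) (m : ℕ) {w : List ℕ}
    (hw : ∀ i ∈ w, 1 ≤ i ∧ i < n) : profile (tauWord w u) m = w.foldl relax (profile u m) := by
  induction w generalizing u with
  | nil => rfl
  | cons a w ih =>
    have := ih (tau a u) fun i hi => hw i (List.mem_cons_of_mem _ hi)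
    simp only [tauWord, List.foldl_cons] at this ⊢
    rw [this, profile_tau u m (hw a List.mem_cons_self).1 (hw a List.mem_cons_self).2]

/-! ### One round of a Coxeter word -/

/-- Compatibility of the relative order of two letters `a`, `b`, in this order, with the steps of
a path: `E i` says that the step from content `i` to content `i + 1` goes east. -/
def OrderedBy (E : ℕ → Prop) (a b : ℕ) : Prop := (b = a + 1 → E a) ∧ (a = b + 1 → ¬ E b)

theorem foldl_relax_of_notMem (f : ℕ → ℤ) {w : List ℕ} {i : ℕ} (hi : i ∉ w) :
    w.foldl relax f i = f i := by
  induction w generalizing f with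
  | nil => rfl
  | cons a w ih =>
    rw [List.mem_cons, not_or] at hi
    rw [List.foldl_cons, ih _ hi.2, relax, Function.update_of_ne hi.1]

open Classical in
-- Each letter is applied once, so a neighbour of i contributes its new value if its letter precedes
-- i and its old value otherwise; `E` records which. Neighbours that are not letters never change,
-- so both readings agree there. The induction removes the last letter.
theorem foldl_relax_of_mem (E : ℕ → Prop) (f : ℕ → ℤ) {w : List ℕ} (hn : w.Nodup)
    (hE : w.Pairwise (OrderedBy E)) (h0 : 0 ∉ w) {i : ℕ} (hi : i ∈ w) :
    w.foldl relax f i = max (if E (i - 1) then w.foldl relax f (i - 1) else f (i - 1))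
      ((if E i then f (i + 1) else w.foldl relax f (i + 1)) - 1) := by
  induction w using List.reverseRecOn generalizing i with
  | nil => simp at hi
  | append_singleton w a ih =>
    rw [List.nodup_append] at hn
    rw [List.pairwise_append] at hE
    simp only [List.mem_append, List.mem_singleton, not_or] at h0 hi
    have haw : a ∉ w := fun h => hn.2.2 a h a (List.mem_singleton_self a) rfl
    have hw : ∀ b ∈ w, OrderedBy E b a := fun b hb => hE.2.2 b hb a (List.mem_singleton_self a)
    have ha : 1 ≤ a := Nat.one_le_iff_ne_zero.2 fun h => h0.2 h.symm
    simp only [List.foldl_append, List.foldl_cons, List.foldl_nil]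
    set g := w.foldl relax f with hg
    have hga : ∀ j, j ≠ a → relax g a j = g j := fun j hj => Function.update_of_ne hj _ _
    by_cases hia : i = a
    · subst hia
      rw [hga (i - 1) (by omega), hga (i + 1) (by omega)]
      have hself : relax g i i = max (g (i - 1)) (g (i + 1) - 1) := Function.update_self _ _ _
      rw [hself]
      congr 1
      · split_ifs with h
        · rfl
        · exact foldl_relax_of_notMem f fun hm => h ((hw _ hm).1 (by omega))
      · congr 1
        split_ifs with h
        · exact foldl_relax_of_notMem f fun hm => (hw _ hm).2 rfl h
        · rfl
    · have hiw : i ∈ w := hi.resolve_right hia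
      have hi1 : 1 ≤ i := Nat.one_le_iff_ne_zero.2 fun h => h0.1 (h ▸ hiw)
      rw [hga i hia, ih hn.1 hE.1 h0.1 hiw]
      congr 1
      · split_ifs with h
        · rw [hga]
          rintro rfl
          exact (hw i hiw).2 (by omega) h
        · rfl
      · congr 1
        split_ifs with h
        · rfl
        · rw [hga]
          rintro rfl
          exact h ((hw i hiw).1 rfl)

end Discrete

/-! ### The last-passage formula -/

section LastPassage

open Classical in
/-- `x k` is the abscissa at content `k` of the path starting at the origin with east steps
prescribed by `E`. -/
structure IsPath (n : ℕ) (E : ℕ → Prop) (x : ℕ → ℤ) : Prop where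
  zero : x 0 = 0
  succ : ∀ k < n, x (k + 1) = x k + if E k then 1 else 0

open Classical in
/-- The evolution of a profile: `h t` is the profile after `t` rounds of updates performed in an
order compatible with `E`. -/
structure IsEvolution (n : ℕ) (E : ℕ → Prop) (h : ℕ → ℕ → ℤ) : Prop where
  left : ∀ t, h t 0 = 0
  right : ∀ t, h t n = h 0 n
  mono : Monotone (h 0)
  succ_le : ∀ k, h 0 (k + 1) ≤ h 0 k + 1
  step : ∀ t i, 1 ≤ i → i < n → h (t + 1) i =
    max (if E (i - 1) then h (t + 1) (i - 1) else h t (i - 1))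
      ((if E i then h t (i + 1) else h (t + 1) (i + 1)) - 1)

variable {n : ℕ} {E : ℕ → Prop} {x : ℕ → ℤ} {h : ℕ → ℕ → ℤ}

theorem IsPath.le_add (hx : IsPath n E x) {i j : ℕ} (hij : i ≤ j) (hj : j ≤ n) :
    x i ≤ x j ∧ x j ≤ x i + (j - i) := by
  induction j, hij using Nat.le_induction with
  | base => simp
  | succ j hij ih =>
    have := ih (by omega)
    have := hx.succ j (by omega)
    split_ifs at this <;> omega

theorem add_le_of_succ_le {f : ℕ → ℤ} (hf : ∀ k, f (k + 1) ≤ f k + 1) {i j : ℕ} (hij : i ≤ j) :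
    f j ≤ f i + (j - i) := by
  induction j, hij using Nat.le_induction with
  | base => simp
  | succ j hij ih =>
    have := hf j
    push_cast
    omega

/-- The updated value at `i` in round `t + 1` comes from two neighbours at the adjacent lattice
points. -/
theorem IsEvolution.exists_step (hh : IsEvolution n E h) (hx : IsPath n E x) (t : ℕ) {i : ℕ}
    (h1 : 1 ≤ i) (h2 : i < n) : ∃ s r : ℕ, h (t + 1) i = max (h s (i - 1)) (h r (i + 1) - 1) ∧
      x (i - 1) + s = x i + t ∧ x (i + 1) + r = x i + (t + 1) := by
  classical
  have e1 := hx.succ (i - 1) (by omega)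
  have e2 := hx.succ i h2
  rw [Nat.sub_add_cancel h1] at e1
  refine ⟨if E (i - 1) then t + 1 else t, if E i then t else t + 1, ?_, ?_, ?_⟩
  · rw [hh.step t i h1 h2]
    split_ifs <;> rfl
  · split_ifs at e1 ⊢ <;> push_cast <;> omega
  · split_ifs at e2 ⊢ <;> push_cast <;> omega

/-- Follow a monotone route back from the point of (t, i) towards the point of j: west as long as
its abscissa allows, then south. If a boundary line or the initial path is met earlier, monotonicity
and the Lipschitz bound of the initial profile show that the value there is already large enough.
`N` bounds the sum of the two coordinates plus n, which drops by one at each step. -/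
theorem IsEvolution.lower (hh : IsEvolution n E h) (hx : IsPath n E x) {j : ℕ} (hj : j ≤ n) :
    ∀ (N t i : ℕ), i ≤ n → 2 * t + 2 * x i - i + n ≤ N → x j ≤ x i + t →
      x j - j ≤ x i - i + t → h 0 j + (x j - j) - (x i - i) - t ≤ h t i := by
  intro N
  have hx0 : ∀ k ≤ n, 0 ≤ x k := fun k hk => hx.zero ▸ (hx.le_add (Nat.zero_le k) hk).1
  have hj0 : h 0 j ≤ j := by
    have := add_le_of_succ_le hh.succ_le (Nat.zero_le j)
    rw [hh.left] at this
    simpa using this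
  induction N with
  | zero =>
    intro t i hi hN ha hb
    have := hx0 i hi
    have hin : i = n := by omega
    subst hin
    have := hh.mono hj
    have := hh.right t
    omega
  | succ N ih =>
    intro t i hi hN ha hb
    rcases Nat.eq_zero_or_pos i with rfl | hi0
    · have := hh.left t
      have := hx.zero
      push_cast
      omega
    rcases hi.eq_or_lt with rfl | hin
    · have := hh.mono hj
      have := hh.right t
      omega
    rcases t with - | t
    · rcases le_total j i with hji | hji
      · have := hx.le_add hji hi
        have := hh.mono hji
        push_cast at *
        omega
      · have := hx.le_add hji hj
        have := add_le_of_succ_le hh.succ_le hji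
        push_cast at *
        omega
    · obtain ⟨s, r, hmax, hs, hr⟩ := hh.exists_step hx t hi0 hin
      have hc : ((i - 1 : ℕ) : ℤ) = i - 1 := by omega
      push_cast at *
      by_cases h1 : x j ≤ x i + t
      · have := ih s (i - 1) (by omega) (by omega) (by omega) (by omega)
        have := le_max_left (h s (i - 1)) (h r (i + 1) - 1)
        omega
      · have hne : i ≠ j := by
          rintro rfl
          omega
        have := ih r (i + 1) (by omega) (by push_cast; omega) (by omega) (by push_cast; omega)
        push_cast at this
        have := le_max_right (h s (i - 1)) (h r (i + 1) - 1)
        omega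

/-- Trace back the neighbour that realises the maximum. Each of the three alternatives is stable
under a west step of cost 0 and a south step of cost 1; they correspond to the trace ending on the
line i = 0, on the line i = n, or on the initial path. -/
theorem IsEvolution.upper (hh : IsEvolution n E h) (hx : IsPath n E x) :
    ∀ (N t i : ℕ), i ≤ n → 2 * t + 2 * x i - i + n ≤ N → h t i ≤ 0 ∨ h t i ≤ i + h 0 n - n ∨
      ∃ j ≤ n, x j ≤ x i + t ∧ x j - j ≤ x i - i + t ∧
        h t i ≤ h 0 j + (x j - j) - (x i - i) - t := by
  intro N
  have hx0 : ∀ k ≤ n, 0 ≤ x k := fun k hk => hx.zero ▸ (hx.le_add (Nat.zero_le k) hk).1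
  induction N with
  | zero =>
    intro t i hi hN
    have := hx0 i hi
    have hin : i = n := by omega
    subst hin
    have := hh.right t
    omega
  | succ N ih =>
    intro t i hi hN
    rcases Nat.eq_zero_or_pos i with rfl | hi0
    · exact Or.inl (hh.left t).le
    rcases hi.eq_or_lt with rfl | hin
    · have := hh.right t
      omega
    rcases t with - | t
    · exact Or.inr (Or.inr ⟨i, hi, by simp, by simp, by simp⟩)
    · obtain ⟨s, r, hmax, hs, hr⟩ := hh.exists_step hx t hi0 hin
      have hc : ((i - 1 : ℕ) : ℤ) = i - 1 := by omega
      push_cast at *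
      rcases max_choice (h s (i - 1)) (h r (i + 1) - 1) with h1 | h1
      · rcases ih s (i - 1) (by omega) (by omega) with h2 | h2 | ⟨j, hj, h3, h4, h5⟩
        · omega
        · omega
        · exact Or.inr (Or.inr ⟨j, hj, by omega, by omega, by omega⟩)
      · rcases ih r (i + 1) (by omega) (by push_cast; omega) with h2 | h2 | ⟨j, hj, h3, h4, h5⟩
        · omega
        · push_cast at h2
          omega
        · push_cast at *
          exact Or.inr (Or.inr ⟨j, hj, by omega, by omega, by omega⟩)

end LastPassage

/-! ### Profiles under iterated Coxeter words -/

section Rounds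

variable {n : ℕ}

theorem isEvolution_profile (u : Equiv.Perm (Fin n)) {m : ℕ} (hm : m ≤ n) {w : List ℕ}
    (hw : IsCoxeterWord n w) {E : ℕ → Prop} (hE : w.Pairwise (OrderedBy E)) :
    IsEvolution n E fun t => profile ((tauWord w)^[t] u) m where
  left t := by simp [profile, cornerCount_zero]
  right t := by simp [profile, cornerCount_full_right _ hm]
  mono k l h := by
    have := cornerCount_mono u m h
    simpa [profile] using this
  succ_le k := by
    have := cornerCount_succ_le u m k
    simp only [profile, Function.iterate_zero, id]
    omega
  step t i h1 h2 := by
    have h0 : 0 ∉ w := fun h => by simpa using ((hw.2 0).1 h).1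
    simp only [Function.iterate_succ_apply', profile_tauWord _ m fun i hi => (hw.2 i).1 hi]
    exact foldl_relax_of_mem E _ hw.1 hE h0 ((hw.2 i).2 ⟨h1, h2⟩)

end Rounds

/-! ### Words corresponding to lattice paths -/

/-- `OrderedBy` constrains only letters differing by one, and a commutation move never exchanges
such letters. -/
theorem CommMove.pairwise_orderedBy {E : ℕ → Prop} {w w' : List ℕ} (h : CommMove w w')
    (hw : w'.Pairwise (OrderedBy E)) : w.Pairwise (OrderedBy E) := by
  obtain ⟨p, q, i, j, hij, rfl, rfl⟩ := h
  have hR : OrderedBy E i j := ⟨fun _ => by omega, fun _ => by omega⟩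
  simp only [List.pairwise_append, List.pairwise_cons, List.mem_cons] at hw ⊢
  obtain ⟨h1, ⟨h2, h3, h4⟩, h5⟩ := hw
  refine ⟨h1, ⟨?_, fun b hb => h2 b (Or.inr hb), h4⟩, fun a ha b hb => h5 a ha b (by tauto)⟩
  rintro b (rfl | hb)
  · exact hR
  · exact h3 b hb

theorem CommEquiv.pairwise_orderedBy {E : ℕ → Prop} {w w' : List ℕ} (h : CommEquiv w w')
    (hw : w'.Pairwise (OrderedBy E)) : w.Pairwise (OrderedBy E) := by
  induction h using Relation.ReflTransGen.head_induction_on with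
  | refl => exact hw
  | head h _ ih => exact h.pairwise_orderedBy ih

namespace LatticePath

variable {n : ℕ}

/-- The step from content `i` to content `i + 1` goes east. -/
def IsEast (L : LatticePath n) (i : ℕ) : Prop := ∃ h : i < n, L.steps ⟨i, h⟩ = Dir.east

open Classical in
theorem xCoord_succ (L : LatticePath n) {k : ℕ} (hk : k < n) :
    L.xCoord (k + 1) = L.xCoord k + if L.IsEast k then 1 else 0 := by
  have h : (Finset.univ.filter fun j : Fin n => (j : ℕ) < k + 1 ∧ L.steps j = Dir.east) =
      (Finset.univ.filter fun j : Fin n => (j : ℕ) < k ∧ L.steps j = Dir.east) ∪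
        (Finset.univ.filter fun j : Fin n => j = ⟨k, hk⟩ ∧ L.steps j = Dir.east) := by
    ext r
    simp only [Finset.mem_filter, Finset.mem_univ, true_and, Finset.mem_union, Fin.ext_iff]
    rw [← or_and_right, Nat.lt_succ_iff_lt_or_eq]
  have h2 : (Finset.univ.filter fun j : Fin n => j = ⟨k, hk⟩ ∧ L.steps j = Dir.east).card =
      if L.IsEast k then 1 else 0 := by
    split_ifs with hp
    · rw [Finset.card_eq_one]
      refine ⟨⟨k, hk⟩, ?_⟩
      ext r
      simp only [Finset.mem_filter, Finset.mem_univ, true_and, Finset.mem_singleton]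
      exact ⟨fun h => h.1, fun h => ⟨h, h ▸ hp.2⟩⟩
    · rw [Finset.card_eq_zero, Finset.filter_eq_empty_iff]
      rintro r - ⟨rfl, hr⟩
      exact hp ⟨hk, hr⟩
  rw [xCoord, h, Finset.card_union_of_disjoint, h2, xCoord]
  · push_cast
    ring
  · rw [Finset.disjoint_filter]
    rintro r - h1 ⟨rfl, -⟩
    exact lt_irrefl _ h1.1

theorem xCoord_zero (L : LatticePath n) : L.xCoord 0 = L.start := by simp [xCoord]

theorem isPath (L : LatticePath n) (h : L.start = 0) : IsPath n L.IsEast L.xCoord :=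
  ⟨L.xCoord_zero.trans h, fun _ hk => L.xCoord_succ hk⟩

/-- Turning the first step east shifts every later vertex by one, and the last step has not been
reached at an interior content. Hence the shape has exactly one box for each letter, with its
lower-left vertex on `L`. -/
theorem xCoord_flipEnds (L : LatticePath n) (h : ∀ j : Fin n, (j : ℕ) = 0 → L.steps j = Dir.south)
    {k : ℕ} (h1 : 1 ≤ k) (hk : k < n) : L.flipEnds.xCoord k = L.xCoord k + 1 := by
  induction k, h1 using Nat.le_induction with
  | base =>
    have hL : ¬ L.IsEast 0 := fun ⟨h0, he⟩ => by simp [h ⟨0, h0⟩ rfl] at he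
    have hF : L.flipEnds.IsEast 0 := ⟨by omega, by simp [flipEnds]⟩
    rw [xCoord_succ _ (by omega), xCoord_succ _ (by omega), if_neg hL, if_pos hF, xCoord_zero,
      xCoord_zero]
    simp [flipEnds]
  | succ k h1 ih =>
    have : L.flipEnds.IsEast k ↔ L.IsEast k := by
      refine exists_congr fun hk' => ?_
      simp only [flipEnds]
      rw [if_neg (by omega), if_neg (by omega)]
    rw [xCoord_succ _ (by omega), xCoord_succ _ (by omega), ih (by omega)]
    by_cases hE : L.IsEast k
    · rw [if_pos hE, if_pos (this.2 hE)]
    · rw [if_neg hE, if_neg fun h => hE (this.1 h)]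
      ring

theorem theta_nat_sub_le (L : LatticePath n) (h : L.start = 0) {z : ℝ} (hz : z ∈ Set.Icc (0 : ℝ) 1)
    (hn : 0 < n) : |n * L.theta z - L.xCoord ⌊n * z⌋₊| ≤ 1 := by
  have hn' : (0 : ℝ) < n := by exact_mod_cast hn
  set k := ⌊n * z⌋₊ with hk
  have hnz : 0 ≤ n * z := mul_nonneg hn'.le hz.1
  have hk1 : (k : ℝ) ≤ n * z := Nat.floor_le hnz
  have hk2 : n * z < k + 1 := Nat.lt_floor_add_one _
  have hkn : k ≤ n := by
    have : (k : ℝ) ≤ n := hk1.trans (by nlinarith [hz.2])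
    exact_mod_cast this
  have h1 : n * L.theta z - L.xCoord k = (n * z - k) * ((L.xCoord (k + 1) : ℝ) - L.xCoord k) := by
    rw [theta, ← hk, mul_div_cancel₀ _ hn'.ne']
    ring
  rw [h1]
  -- At k = n the next vertex lies beyond the end of the path, but its interpolation coefficient
  -- vanishes.
  rcases hkn.eq_or_lt with hkn | hkn
  · have : n * z - k = 0 := by
      have : n * z ≤ n := by nlinarith [hz.2]
      rw [hkn] at hk1 ⊢
      linarith
    rw [this]
    simp
  · have h2 := (L.isPath h).le_add (Nat.le_succ k) hkn
    rw [Nat.succ_eq_add_one] at h2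
    have h3 : (L.xCoord k : ℝ) ≤ L.xCoord (k + 1) := by exact_mod_cast h2.1
    have h4 : (L.xCoord (k + 1) : ℝ) ≤ L.xCoord k + 1 := by
      have := h2.2
      push_cast at this
      have h5 : L.xCoord (k + 1) ≤ L.xCoord k + 1 := by omega
      exact_mod_cast h5
    rw [abs_of_nonneg (mul_nonneg (by linarith) (by linarith))]
    nlinarith

end LatticePath

/-- The box of content i sits at the vertex of `L` of content i. An east step puts box i+1 to the
right of box i, hence later in the linear extension; a south step puts it below, hence earlier.
Commutation preserves these relations. -/
theorem Corresponds.pairwise_orderedBy {n : ℕ} {w : List ℕ} {L : LatticePath n}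
    (h : Corresponds w L) : w.Pairwise (OrderedBy L.IsEast) := by
  obtain ⟨l, ⟨hl1, hl2, hl3⟩, hw⟩ := h.word
  refine hw.pairwise_orderedBy (List.pairwise_map.2 (hl3.imp_of_mem ?_))
  have hb : ∀ b ∈ l, ∃ i : ℕ, i < n ∧ (content b).toNat = i ∧ b.1 = L.xCoord i ∧
      b.2 = L.xCoord i - i := by
    intro b hb
    obtain ⟨i, h1, h2, h3, h4, h5⟩ := (hl2 b).1 hb
    rw [L.xCoord_flipEnds h.first_step h1 h2] at h5
    refine ⟨i, h2, by omega, by omega, ?_⟩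
    rw [content] at h3
    omega
  intro b b' hbl hbl' hbb'
  obtain ⟨i, hi, hc, hx, hy⟩ := hb b hbl
  obtain ⟨i', hi', hc', hx', hy'⟩ := hb b' hbl'
  rw [hc, hc', OrderedBy]
  rw [Prod.le_def, hx, hx', hy, hy'] at hbb'
  constructor
  · rintro rfl
    by_contra hE
    refine hbb' ?_
    rw [L.xCoord_succ hi, if_neg hE]
    push_cast
    constructor <;> omega
  · rintro rfl hE
    refine hbb' ?_
    rw [L.xCoord_succ hi', if_pos hE]
    push_cast
    constructor <;> omega

/-- Pointwise convergence of the functions `θ` gives uniform convergence of the abscissas. -/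
theorem eventually_xCoord_sub_le {β : ℝ} (hβ : β ∈ Set.Icc (0 : ℝ) 1) {L : ∀ n : ℕ+, LatticePath n}
    (h0 : ∀ n : ℕ+, 2 ≤ n → (L n).start = 0)
    (h : ∀ z ∈ Set.Icc (0 : ℝ) 1, Tendsto (fun n : ℕ+ => (L n).theta z) atTop (𝓝 (β * z)))
    {ε : ℝ} (hε : 0 < ε) :
    ∀ᶠ n : ℕ+ in atTop, ∀ j ≤ (n : ℕ), |((L n).xCoord j : ℝ) - β * j| ≤ ε * n := by
  -- Control on a grid of mesh 1/M suffices, since the abscissa is monotone and 1-Lipschitz. The 8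
  -- leaves room for the grid error, the mesh, and the roundings in `theta` and in the floor.
  obtain ⟨M, hM⟩ := exists_nat_gt (8 / ε)
  have hM0 : (0 : ℝ) < M := (by positivity : (0 : ℝ) < 8 / ε).trans hM
  have hMε : 1 / (M : ℝ) < ε / 8 := by
    rw [div_lt_div_iff₀ hM0 (by norm_num)]
    rw [div_lt_iff₀ hε] at hM
    linarith
  have hgrid : ∀ᶠ n : ℕ+ in atTop, ∀ l ∈ Finset.range (M + 1),
      |(L n).theta (l / M) - β * (l / M)| < ε / 8 := by
    rw [Filter.eventually_all_finset]
    intro l hl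
    have hl' : (l : ℝ) ≤ M := by exact_mod_cast Nat.lt_succ_iff.1 (Finset.mem_range.1 hl)
    have := Metric.tendsto_nhds.1 (h (l / M) ⟨by positivity, div_le_one_of_le₀ hl' hM0.le⟩)
      (ε / 8) (by positivity)
    simpa only [Real.dist_eq] using this
  have hbig : ∀ᶠ n : ℕ+ in atTop, 8 / ε ≤ ((n : ℕ) : ℝ) :=
    (tendsto_natCast_atTop_atTop.comp tendsto_PNat_val_atTop_atTop).eventually_ge_atTop _
  filter_upwards [hgrid, hbig, eventually_ge_atTop (2 : ℕ+)] with n hn hnε hn2 j hj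
  have hn0 : (0 : ℝ) < (n : ℕ) := by exact_mod_cast n.pos
  have hnε' : 1 ≤ ε / 8 * (n : ℕ) := by
    rw [div_le_iff₀ hε] at hnε
    linarith
  have hjn : (j : ℝ) ≤ (n : ℕ) := by exact_mod_cast hj
  set l := ⌊(j : ℝ) * M / (n : ℕ)⌋₊ with hl
  have hl1 : (l : ℝ) ≤ j * M / (n : ℕ) := Nat.floor_le (by positivity)
  have hl2 : (j : ℝ) * M / (n : ℕ) < l + 1 := Nat.lt_floor_add_one _
  have hlM : (l : ℝ) ≤ M := hl1.trans (by
    rw [div_le_iff₀ hn0, mul_comm]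
    exact mul_le_mul_of_nonneg_left hjn hM0.le)
  have hz : (l / M : ℝ) ∈ Set.Icc (0 : ℝ) 1 := ⟨by positivity, div_le_one_of_le₀ hlM hM0.le⟩
  have hg := hn l (Finset.mem_range.2 (Nat.lt_succ_iff.2 (by exact_mod_cast hlM)))
  set z : ℝ := l / M with hzdef
  have hzM : z * M = l := div_mul_cancel₀ _ hM0.ne'
  have ht := (L n).theta_nat_sub_le (h0 n hn2) hz n.pos
  set k := ⌊((n : ℕ) : ℝ) * z⌋₊ with hk
  have hnz : 0 ≤ ((n : ℕ) : ℝ) * z := mul_nonneg hn0.le hz.1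
  have hk1 : (k : ℝ) ≤ (n : ℕ) * z := Nat.floor_le hnz
  have hk2 : ((n : ℕ) : ℝ) * z < k + 1 := Nat.lt_floor_add_one _
  have hj1 : (n : ℕ) * z ≤ (j : ℝ) := by
    rw [le_div_iff₀ hn0, ← hzM] at hl1
    nlinarith
  have hj2 : (j : ℝ) ≤ (n : ℕ) * z + (n : ℕ) * (ε / 8) := by
    rw [div_lt_iff₀ hn0, ← hzM] at hl2
    have h1 : (j : ℝ) ≤ (n : ℕ) * z + (n : ℕ) * (1 / M) := by
      rw [← sub_nonneg]
      have : (n : ℕ) * z + (n : ℕ) * (1 / M) - (j : ℝ) = ((z * M + 1) * (n : ℕ) - j * M) / M := by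
        field_simp
      rw [this]
      exact div_nonneg (by linarith) hM0.le
    nlinarith
  have hkj : k ≤ j := by exact_mod_cast hk1.trans hj1
  have hp := ((L n).isPath (h0 n hn2)).le_add hkj hj
  have hp1 : ((L n).xCoord k : ℝ) ≤ (L n).xCoord j := by exact_mod_cast hp.1
  have hp2 : ((L n).xCoord j : ℝ) ≤ (L n).xCoord k + (j - k) := by exact_mod_cast hp.2
  rw [abs_le] at ht ⊢
  rw [abs_lt] at hg
  have hg1 : (n : ℕ) * (L n).theta z - (n : ℕ) * (β * z) ≤ ε / 8 * (n : ℕ) := by nlinarith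
  have hg2 : -(ε / 8 * (n : ℕ)) ≤ (n : ℕ) * (L n).theta z - (n : ℕ) * (β * z) := by nlinarith
  have hb1 : 0 ≤ β * (j - (n : ℕ) * z) := mul_nonneg hβ.1 (by linarith)
  have hb2 : β * (j - (n : ℕ) * z) ≤ j - (n : ℕ) * z :=
    mul_le_of_le_one_left (by linarith) hβ.2
  constructor <;> linarith

theorem isCoxeterWord_range' (n : ℕ+) : IsCoxeterWord n (List.range' 1 ((n : ℕ) - 1)) := by
  refine ⟨List.nodup_range', fun i => ?_⟩
  have := n.pos
  rw [List.mem_range'_1]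
  omega

/-- The first and last steps of a path do not influence the order of letters in [1, n-1], so the
all-east path serves for the bubble-sort word. Its abscissas are exactly k, which makes the case β =
1 error-free. -/
theorem pairwise_orderedBy_range' (k : ℕ) :
    (List.range' 1 k).Pairwise (OrderedBy fun _ => True) := by
  refine (List.pairwise_lt_range' (s := 1) (n := k)).imp fun {a b} hab => ⟨fun _ => trivial, fun h => ?_⟩
  omega

theorem isPath_natCast (n : ℕ) : IsPath n (fun _ => True) fun k => (k : ℤ) :=
  ⟨rfl, fun k _ => by simp⟩

/-! ### The scaling limit of profiles -/

/-- The minimum of `y / (1 - β)` and `(1 - y) / β`, quotients by `0` being infinite. -/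
noncomputable def tent (β y : ℝ) : ℝ := if y ≤ 1 - β then y / (1 - β) else (1 - y) / β

/-- The distribution function of the limit measure. -/
noncomputable def limitCDF (α β z y : ℝ) : ℝ := max 0 (max (z + y - 1) (z * y - α * tent β y))

/-- The quantity maximised over `w` in the limit of the last-passage formula. -/
def passage (α β z y w : ℝ) : ℝ := (1 - β) * (z - w) - α + w * y

/-- With r = `tent β y`, the difference `passage` - (zy - αr) equals (1-r)((1-β)(z-w) - α) when y ≤
1-β and (1-r)(β(w-z) - α) otherwise, where 0 ≤ r ≤ 1. Only the constraint that binds at the maximum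
is used in each case; `δ` absorbs discretisation errors. -/
theorem passage_le {α β z y w δ : ℝ} (hα : 0 < α) (hβ : β ∈ Set.Icc (0 : ℝ) 1)
    (hy : y ∈ Set.Icc (0 : ℝ) 1) (hδ : 0 ≤ δ) (h1 : (1 - β) * (z - w) ≤ α + δ)
    (h2 : β * (w - z) ≤ α + δ) : passage α β z y w ≤ z * y - α * tent β y + δ := by
  rw [passage, tent]
  split_ifs with h
  · rcases hβ.2.eq_or_lt with rfl | hβ1
    · have : y = 0 := le_antisymm (by simpa using h) hy.1
      subst this
      simp
      linarith
    · have hb : 0 < 1 - β := by linarith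
      set r := y / (1 - β) with hr
      have hry : y = r * (1 - β) := (div_mul_cancel₀ _ hb.ne').symm
      have hr0 : 0 ≤ r := div_nonneg hy.1 hb.le
      have hr1 : r ≤ 1 := div_le_one_of_le₀ h hb.le
      rw [hry]
      nlinarith [mul_le_mul_of_nonneg_left h1 (sub_nonneg.2 hr1), mul_nonneg hδ hr0]
  · push Not at h
    have hb : 0 < β := by linarith [hy.2]
    set r := (1 - y) / β with hr
    have hry : y = 1 - r * β := by rw [hr, div_mul_cancel₀ _ hb.ne']; ring
    have hr0 : 0 ≤ r := div_nonneg (by linarith [hy.2]) hb.le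
    have hr1 : r ≤ 1 := div_le_one_of_le₀ (by linarith) hb.le
    rw [hry]
    nlinarith [mul_le_mul_of_nonneg_left h2 (sub_nonneg.2 hr1), mul_nonneg hδ hr0]

/-- The maximum is at the endpoint z - α/(1-β) or z + α/β, according to the sign of the slope y -
(1-β). Beating 0 strictly keeps the first endpoint nonnegative, and beating z+y-1 strictly keeps the
second below 1. -/
theorem exists_passage_eq {α β z y : ℝ} (hα : 0 < α)
    (hz : z ∈ Set.Icc (0 : ℝ) 1) (hy : y ∈ Set.Icc (0 : ℝ) 1) (h0 : 0 < z * y - α * tent β y)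
    (h1 : z + y - 1 < z * y - α * tent β y) :
    ∃ w ∈ Set.Icc (0 : ℝ) 1, (1 - β) * (z - w) ≤ α ∧ β * (w - z) ≤ α ∧
      passage α β z y w = z * y - α * tent β y := by
  rw [tent] at h0 h1 ⊢
  split_ifs at h0 h1 ⊢ with h
  · have hy0 : 0 < y := hy.1.lt_of_ne (by rintro rfl; simp at h0)
    have hb : 0 < 1 - β := by linarith
    have hc : 0 < α / (1 - β) := div_pos hα hb
    have e : α * (y / (1 - β)) = α / (1 - β) * y := by ring
    have e2 : (1 - β) * (α / (1 - β)) = α := mul_div_cancel₀ _ hb.ne'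
    rw [e] at h0 h1 ⊢
    refine ⟨z - α / (1 - β), ⟨?_, by linarith [hz.2]⟩, ?_, ?_, ?_⟩
    · by_contra hlt
      push Not at hlt
      nlinarith
    · rw [sub_sub_cancel, e2]
    · nlinarith
    · rw [passage, sub_sub_cancel, e2]
      ring
  · push Not at h
    have hb : 0 < β := by linarith [hy.2]
    have hc : 0 < α / β := div_pos hα hb
    have e : α * ((1 - y) / β) = α / β * (1 - y) := by ring
    have e2 : β * (α / β) = α := mul_div_cancel₀ _ hb.ne'
    rw [e] at h0 h1 ⊢
    refine ⟨z + α / β, ⟨by linarith [hz.1], ?_⟩, ?_, ?_, ?_⟩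
    · by_contra hlt
      push Not at hlt
      nlinarith [hy.2]
    · nlinarith
    · rw [add_sub_cancel_left, e2]
    · rw [passage]
      linear_combination e2

/-- At w = z both constraints are strict because α > 0. Moving the maximiser a small fraction `s`
towards z makes them strict at a cost of at most `η`, leaving room for errors in the discrete
constraints. -/
theorem exists_lt_passage {α β z y η : ℝ} (hα : 0 < α)
    (hz : z ∈ Set.Icc (0 : ℝ) 1) (hy : y ∈ Set.Icc (0 : ℝ) 1) (hη : 0 < η)
    (h0 : 0 < z * y - α * tent β y) (h1 : z + y - 1 < z * y - α * tent β y) :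
    ∃ w ∈ Set.Icc (0 : ℝ) 1, (1 - β) * (z - w) < α ∧ β * (w - z) < α ∧
      z * y - α * tent β y - η ≤ passage α β z y w := by
  obtain ⟨w, hw, h2, h3, h4⟩ := exists_passage_eq hα hz hy h0 h1
  set C := |passage α β z y z - passage α β z y w| + 1 with hC
  have hC0 : 0 < C := by positivity
  set s := min 1 (η / C) with hs
  have hs0 : 0 < s := lt_min one_pos (div_pos hη hC0)
  have hs1 : s ≤ 1 := min_le_left _ _
  have hsη : s * C ≤ η := by
    have := mul_le_mul_of_nonneg_right (min_le_right 1 (η / C)) hC0.le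
    rwa [div_mul_cancel₀ _ hC0.ne'] at this
  refine ⟨w + s * (z - w), ⟨?_, ?_⟩, ?_, ?_, ?_⟩
  · nlinarith [hw.1, hz.1]
  · nlinarith [hw.2, hz.2]
  · nlinarith
  · nlinarith
  · have e : passage α β z y (w + s * (z - w)) =
        passage α β z y w + s * (passage α β z y z - passage α β z y w) := by
      simp only [passage]
      ring
    rw [e, h4]
    have := neg_abs_le (passage α β z y z - passage α β z y w)
    nlinarith

theorem mul_floor_mem {c w N δ : ℝ} (hc : c ∈ Set.Icc (0 : ℝ) 1) (hw : 0 ≤ w) (hN : 0 ≤ N)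
    (hδ : 1 ≤ δ * N) :
    c * ⌊N * w⌋₊ ∈ Set.Icc (c * w * N - δ * N) (c * w * N) := by
  have h1 := Nat.floor_le (mul_nonneg hN hw)
  have h2 := Nat.lt_floor_add_one (N * w)
  have h3 := mul_le_mul_of_nonneg_left h1 hc.1
  have h4 := mul_le_mul_of_nonneg_left h2.le hc.1
  constructor <;> nlinarith [hc.2]

/-! ### Passing to the limit in the last-passage formula -/

section Scaling

variable {α β z y : ℝ} {E : ℕ+ → ℕ → Prop} {x : ℕ+ → ℕ → ℤ} {h : ℕ+ → ℕ → ℕ → ℤ}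

/-- The lower bound treats the three terms of the limit separately: positivity, the Lipschitz bound
up to n, and the route from a near-optimal starting point. The upper bound matches the three
alternatives of `IsEvolution.upper` with the same terms. -/
theorem tendsto_evolution (hα : 0 < α) (hβ : β ∈ Set.Icc (0 : ℝ) 1)
    (hz : z ∈ Set.Icc (0 : ℝ) 1) (hy : y ∈ Set.Icc (0 : ℝ) 1)
    (hpath : ∀ᶠ n : ℕ+ in atTop, IsPath n (E n) (x n))
    (hevol : ∀ᶠ n : ℕ+ in atTop, IsEvolution n (E n) (h n))
    (hpos : ∀ n t i, 0 ≤ h n t i)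
    (hlip : ∀ (n : ℕ+) (t i : ℕ), i ≤ (n : ℕ) → h n t n ≤ h n t i + (n - i))
    (hx : ∀ ε > 0, ∀ᶠ n : ℕ+ in atTop, ∀ j ≤ (n : ℕ), |(x n j : ℝ) - β * j| ≤ ε * n)
    (h0 : ∀ ε > 0, ∀ᶠ n : ℕ+ in atTop, ∀ j ≤ (n : ℕ), |(h n 0 j : ℝ) - y * j| ≤ ε * n) :
    Tendsto (fun n : ℕ+ => (h n ⌊α * (n : ℕ)⌋₊ ⌊((n : ℕ) : ℝ) * z⌋₊ : ℝ) / (n : ℕ)) atTop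
      (𝓝 (limitCDF α β z y)) := by
  have hbig : ∀ δ : ℝ, 0 < δ → ∀ᶠ n : ℕ+ in atTop, 1 ≤ δ * ((n : ℕ) : ℝ) := fun δ hδ => by
    filter_upwards [(tendsto_natCast_atTop_atTop.comp
      tendsto_PNat_val_atTop_atTop).eventually_ge_atTop (1 / δ)] with n hn
    simp only [Function.comp_apply] at hn
    rwa [div_le_iff₀ hδ, mul_comm] at hn
  have hβ' : 1 - β ∈ Set.Icc (0 : ℝ) 1 := ⟨by linarith [hβ.2], by linarith [hβ.1]⟩
  have h1' : (1 : ℝ) ∈ Set.Icc (0 : ℝ) 1 := by simp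
  have key : ∀ w ∈ Set.Icc (0 : ℝ) 1, ∀ N : ℕ+, ⌊((N : ℕ) : ℝ) * w⌋₊ ≤ (N : ℕ) := by
    intro w hw N
    refine Nat.floor_le_of_le ?_
    exact mul_le_of_le_one_right (Nat.cast_nonneg _) hw.2
  refine tendsto_order.2 ⟨fun a ha => ?_, fun a ha => ?_⟩
  · rw [limitCDF, lt_max_iff, lt_max_iff] at ha
    have htriv : a < 0 → ∀ᶠ n : ℕ+ in atTop,
        a < (h n ⌊α * (n : ℕ)⌋₊ ⌊((n : ℕ) : ℝ) * z⌋₊ : ℝ) / (n : ℕ) := fun ha =>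
      Eventually.of_forall fun n => ha.trans_le (div_nonneg (by exact_mod_cast hpos _ _ _)
        (Nat.cast_nonneg _))
    have hlin : a < z + y - 1 → ∀ᶠ n : ℕ+ in atTop,
        a < (h n ⌊α * (n : ℕ)⌋₊ ⌊((n : ℕ) : ℝ) * z⌋₊ : ℝ) / (n : ℕ) := fun ha => by
      set δ := (z + y - 1 - a) / 4 with hδ
      have hδ0 : 0 < δ := by linarith
      filter_upwards [hbig δ hδ0, h0 δ hδ0, hevol] with n hn h0n hevn
      have hn0 : (0 : ℝ) < (n : ℕ) := by exact_mod_cast n.pos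
      rw [lt_div_iff₀ hn0]
      have e1 := h0n n le_rfl
      rw [← hevn.right ⌊α * (n : ℕ)⌋₊, abs_le] at e1
      have e2 := hlip n ⌊α * (n : ℕ)⌋₊ _ (key z hz n)
      rw [← @Int.cast_le ℝ] at e2
      push_cast at e2
      have e3 := mul_floor_mem h1' hz.1 hn0.le hn
      simp only [one_mul, Set.mem_Icc] at e3
      have e4 : (z + y - 1 - a) * (n : ℕ) = 4 * (δ * (n : ℕ)) := by rw [hδ]; ring
      linarith
    rcases ha with ha | ha | ha
    · exact htriv ha
    · exact hlin ha
    -- Unless the third term strictly dominates the other two, a trivial bound already suffices;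
    -- only then is a starting point inside [0,1] available.
    by_cases hc0 : z * y - α * tent β y ≤ 0
    · exact htriv (ha.trans_le hc0)
    by_cases hc1 : z * y - α * tent β y ≤ z + y - 1
    · exact hlin (ha.trans_le hc1)
    push Not at hc0 hc1
    set η := (z * y - α * tent β y - a) / 2 with hη
    have hη0 : 0 < η := by linarith
    obtain ⟨w, hw, hw1, hw2, hw3⟩ := exists_lt_passage hα hz hy hη0 hc0 hc1
    -- `δ` bounds every error per unit of n: a few of them fit in the slack of each constraint and
    -- in the loss `η`.
    obtain ⟨δ, hδ0, hδ1, hδ2, hδ3⟩ : ∃ δ : ℝ, 0 < δ ∧ 4 * δ ≤ α - (1 - β) * (z - w) ∧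
        4 * δ ≤ α - β * (w - z) ∧ 8 * δ ≤ η := by
      refine ⟨min (min ((α - (1 - β) * (z - w)) / 4) ((α - β * (w - z)) / 4)) (η / 8), ?_, ?_, ?_,
        ?_⟩
      · exact lt_min (lt_min (by linarith) (by linarith)) (by linarith)
      · linarith [(min_le_left (min ((α - (1 - β) * (z - w)) / 4) ((α - β * (w - z)) / 4))
          (η / 8)).trans (min_le_left _ _)]
      · linarith [(min_le_left (min ((α - (1 - β) * (z - w)) / 4) ((α - β * (w - z)) / 4))
          (η / 8)).trans (min_le_right _ _)]
      · linarith [min_le_right (min ((α - (1 - β) * (z - w)) / 4) ((α - β * (w - z)) / 4))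
          (η / 8)]
    filter_upwards [hbig δ hδ0, h0 δ hδ0, hx δ hδ0, hevol, hpath] with n hn h0n hxn hevn hpn
    have hn0 : (0 : ℝ) < (n : ℕ) := by exact_mod_cast n.pos
    have hkn := key z hz n
    have hjn := key w hw n
    set N : ℝ := ((n : ℕ) : ℝ) with hN
    have t1 := Nat.floor_le (mul_nonneg hα.le hn0.le)
    have t2 := Nat.lt_floor_add_one (α * N)
    have k1 := mul_floor_mem hβ hz.1 hn0.le hn
    have k2 := mul_floor_mem hβ' hz.1 hn0.le hn
    have j1 := mul_floor_mem hβ hw.1 hn0.le hn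
    have j2 := mul_floor_mem hβ' hw.1 hn0.le hn
    have j3 := mul_floor_mem hy hw.1 hn0.le hn
    have h0j := h0n _ hjn
    have hxj := hxn _ hjn
    have hxk := hxn _ hkn
    have hlow := hevn.lower hpn hjn _ ⌊α * N⌋₊ ⌊N * z⌋₊ hkn (Int.self_le_toNat _)
    set k := ⌊N * z⌋₊
    set j := ⌊N * w⌋₊
    set t := ⌊α * N⌋₊
    rw [abs_le] at h0j hxj hxk
    simp only [Set.mem_Icc] at k1 k2 j1 j2 j3
    rw [lt_div_iff₀ hn0]
    have d1 := mul_le_mul_of_nonneg_right hδ1 hn0.le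
    have d2 := mul_le_mul_of_nonneg_right hδ2 hn0.le
    have d3 := mul_le_mul_of_nonneg_right hδ3 hn0.le
    have d4 := mul_le_mul_of_nonneg_right hw3 hn0.le
    have d5 : η * N = (z * y - α * tent β y - a) / 2 * N := by rw [hη]
    rw [passage] at d4
    have hlow' := hlow (by
      rw [← @Int.cast_le ℝ]
      push_cast
      linarith) (by
      rw [← @Int.cast_le ℝ]
      push_cast
      linarith)
    rw [← @Int.cast_le ℝ] at hlow'
    push_cast at hlow'
    have hηN : 0 < η * N := mul_pos hη0 hn0
    linarith
  · rw [limitCDF, gt_iff_lt, max_lt_iff, max_lt_iff] at ha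
    obtain ⟨ha0, ha1, ha2⟩ := ha
    set δ := (a - (z * y - α * tent β y)) / 16 with hδ
    set δ' := (a - (z + y - 1)) / 4 with hδ'
    have hδ0 : 0 < δ := by linarith
    have hδ0' : 0 < δ' := by linarith
    filter_upwards [hbig δ hδ0, hbig δ' hδ0', h0 δ hδ0, h0 δ' hδ0', hx δ hδ0, hevol, hpath]
      with n hn hn' h0n h0n' hxn hevn hpn
    have hn0 : (0 : ℝ) < (n : ℕ) := by exact_mod_cast n.pos
    have hkn := key z hz n
    have h0r := h0n' n le_rfl
    set N : ℝ := ((n : ℕ) : ℝ) with hN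
    have t2 := Nat.lt_floor_add_one (α * N)
    have t1 := Nat.floor_le (mul_nonneg hα.le hn0.le)
    have k0 := mul_floor_mem h1' hz.1 hn0.le hn
    have k1 := mul_floor_mem hβ hz.1 hn0.le hn
    have k2 := mul_floor_mem hβ' hz.1 hn0.le hn
    have hxk := hxn _ hkn
    have hup := hevn.upper hpn _ ⌊α * N⌋₊ ⌊N * z⌋₊ hkn (Int.self_le_toNat _)
    set k := ⌊N * z⌋₊
    set t := ⌊α * N⌋₊
    rw [abs_le] at h0r hxk
    simp only [Set.mem_Icc, one_mul] at k0 k1 k2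
    rw [div_lt_iff₀ hn0]
    have d1 : δ * N = (a - (z * y - α * tent β y)) / 16 * N := by rw [hδ]
    have d2 : δ' * N = (a - (z + y - 1)) / 4 * N := by rw [hδ']
    rcases hup with hu | hu | ⟨j, hj, hj1, hj2, hu⟩
    · have hu' : (h n t k : ℝ) ≤ 0 := by exact_mod_cast hu
      have := mul_pos ha0 hn0
      linarith
    · rw [← @Int.cast_le ℝ] at hu
      push_cast at hu
      linarith
    · rw [← @Int.cast_le ℝ] at hu hj1 hj2
      push_cast at hu hj1 hj2
      have h0j := h0n j hj
      have hxj := hxn j hj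
      rw [abs_le] at h0j hxj
      have hw : (j : ℝ) = j / N * N := (div_mul_cancel₀ _ hn0.ne').symm
      set w : ℝ := j / N
      rw [hw] at h0j hxj hj2 hu
      have hp : passage α β z y w ≤ z * y - α * tent β y + 3 * δ := by
        refine passage_le hα hβ hy (by linarith) ?_ ?_
        · refine le_of_mul_le_mul_right ?_ hn0
          linarith
        · refine le_of_mul_le_mul_right ?_ hn0
          linarith
      have d4 := mul_le_mul_of_nonneg_right hp hn0.le
      rw [passage] at d4
      linarith

end Scaling

/-! ### Concentration of corner counts -/

section Concentration

variable {n : ℕ}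

/-- The permutations that map `S` into `A`. -/
def mapsInto (S A : Finset (Fin n)) : Finset (Equiv.Perm (Fin n)) :=
  Finset.univ.filter fun σ => ∀ p ∈ S, σ p ∈ A

theorem card_mapsInto_insert_eq (S A : Finset (Fin n)) {a b : Fin n} (ha : a ∉ S) (hb : b ∉ S) :
    (mapsInto (insert a S) A).card = (mapsInto (insert b S) A).card := by
  refine Finset.card_equiv (Equiv.mulRight (Equiv.swap a b)) fun σ => ?_
  simp only [mapsInto, Finset.mem_filter, Finset.mem_univ, true_and, Finset.forall_mem_insert,
    Equiv.coe_mulRight, Equiv.Perm.mul_apply, Equiv.swap_apply_right]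
  refine and_congr_right fun _ => forall₂_congr fun p hp => ?_
  rw [Equiv.swap_apply_of_ne_of_ne (ne_of_mem_of_not_mem hp ha) (ne_of_mem_of_not_mem hp hb)]

/-- Count pairs (σ, b) with σ mapping S into A, b outside S and σ b in A. Each σ has |A| - |S| such
b, while by symmetry each b outside S has equally many σ. -/
theorem card_mapsInto_insert (S A : Finset (Fin n)) {a : Fin n} (ha : a ∉ S) :
    (n - S.card) * (mapsInto (insert a S) A).card + (mapsInto S A).card * S.card =
      (mapsInto S A).card * A.card := by
  have h1 : (n - S.card) * (mapsInto (insert a S) A).card =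
      ∑ b ∈ Sᶜ, (mapsInto (insert b S) A).card := by
    rw [Finset.sum_congr rfl fun b hb =>
      card_mapsInto_insert_eq S A (Finset.mem_compl.1 hb) ha, Finset.sum_const, Finset.card_compl,
      Fintype.card_fin, smul_eq_mul]
  have h2 : ∀ b ∈ Sᶜ, (mapsInto (insert b S) A).card =
      ∑ σ ∈ mapsInto S A, if σ b ∈ A then 1 else 0 := by
    intro b _
    rw [Finset.sum_boole, Nat.cast_id]
    congr 1
    ext σ
    simp [mapsInto, and_comm]
  have h3 : ∀ σ ∈ mapsInto S A, ((∑ b ∈ Sᶜ, if σ b ∈ A then 1 else 0) + S.card) = A.card := by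
    intro σ hσ
    have hσ' : ∀ p ∈ S, σ p ∈ A := by simpa [mapsInto] using hσ
    have : (∑ b ∈ S, if σ b ∈ A then 1 else 0) = S.card := by
      rw [Finset.sum_congr rfl fun b hb => if_pos (hσ' b hb)]
      simp
    rw [← this, Finset.sum_compl_add_sum, Finset.sum_boole, Nat.cast_id]
    refine Finset.card_equiv σ fun p => ?_
    simp
  rw [h1, Finset.sum_congr rfl h2, Finset.sum_comm, ← smul_eq_mul, ← Finset.sum_const,
    ← Finset.sum_add_distrib, Finset.sum_congr rfl h3, Finset.sum_const, smul_eq_mul]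

/-- Each new point costs a factor (|A| - |S|)/(n - |S|) ≤ |A|/n: sampling without replacement is
dominated by independent sampling. -/
theorem card_mapsInto_le (S A : Finset (Fin n)) :
    ((mapsInto S A).card : ℝ) ≤ n.factorial * (A.card / n) ^ S.card := by
  induction S using Finset.induction_on with
  | empty => simp [mapsInto, Fintype.card_perm]
  | insert a S ha ih =>
    have hS : S.card < n := by
      have := Finset.card_le_univ (insert a S)
      rw [Finset.card_insert_of_notMem ha, Fintype.card_fin] at this
      omega
    have hA : (A.card : ℝ) ≤ n := by
      have := Finset.card_le_univ A
      rw [Fintype.card_fin] at this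
      exact_mod_cast this
    have hn : (0 : ℝ) < n := by exact_mod_cast (Nat.zero_le _).trans_lt hS
    have hS' : (S.card : ℝ) < n := by exact_mod_cast hS
    have h := card_mapsInto_insert S A ha
    rw [← @Nat.cast_inj ℝ] at h
    push_cast [Nat.cast_sub hS.le] at h
    rw [Finset.card_insert_of_notMem ha, pow_succ, ← mul_assoc]
    refine le_trans ?_ (mul_le_mul_of_nonneg_right ih (by positivity))
    rw [← mul_div_assoc, le_div_iff₀ hn]
    have h0 : (0 : ℝ) ≤ (mapsInto S A).card := by positivity
    have h1 : (0 : ℝ) ≤ S.card := by positivity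
    refine le_of_mul_le_mul_left ?_ (sub_pos.2 hS')
    nlinarith [mul_nonneg (mul_nonneg h0 h1) (sub_nonneg.2 hA)]

/-- Expanding (1+s)^count over the subsets of `K` that are mapped into `A` reduces the exponential
moment to `card_mapsInto_le`; the bound is the binomial one. -/
theorem sum_pow_card_le (K A : Finset (Fin n)) {s : ℝ} (hs : 0 ≤ s) :
    ∑ σ : Equiv.Perm (Fin n), (1 + s) ^ (K.filter fun p => σ p ∈ A).card ≤
      n.factorial * (1 + s * (A.card / n)) ^ K.card := by
  have h1 : ∀ σ : Equiv.Perm (Fin n), (1 + s) ^ (K.filter fun p => σ p ∈ A).card =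
      ∑ T ∈ K.powerset, if σ ∈ mapsInto T A then s ^ T.card else 0 := by
    intro σ
    rw [← Finset.prod_const, Finset.prod_filter]
    have : ∀ p ∈ K, (if σ p ∈ A then 1 + s else 1) = 1 + if σ p ∈ A then s else 0 := by
      intro p _
      split_ifs <;> simp
    rw [Finset.prod_congr rfl this, Finset.prod_one_add]
    refine Finset.sum_congr rfl fun T _ => ?_
    rw [Finset.prod_ite_zero, Finset.prod_const]
    simp [mapsInto]
  have h2 : (1 + s * (A.card / n)) ^ K.card = ∑ T ∈ K.powerset, (s * (A.card / n)) ^ T.card := by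
    rw [← Finset.prod_const, Finset.prod_one_add]
    simp
  rw [Finset.sum_congr rfl fun σ _ => h1 σ, Finset.sum_comm, h2, Finset.mul_sum]
  refine Finset.sum_le_sum fun T _ => ?_
  rw [← Finset.sum_filter, Finset.sum_const, Finset.filter_univ_mem, nsmul_eq_mul, mul_pow,
    mul_left_comm, mul_comm]
  exact mul_le_mul_of_nonneg_left (card_mapsInto_le T A) (pow_nonneg hs _)

/-- This is Markov's inequality for (1+ε)^count. The exponent is at most n(ε - (1+ε) log(1+ε)), and
log(1+ε) ≥ 2ε/(ε+2) turns it into -nε²/(ε+2). -/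
theorem card_upper_tail_le (K A : Finset (Fin n)) {ε : ℝ} (hε : 0 < ε) :
    ((Finset.univ.filter fun σ : Equiv.Perm (Fin n) =>
      (K.card * (A.card / n) + ε * n : ℝ) ≤ (K.filter fun p => σ p ∈ A).card).card : ℝ) ≤
      n.factorial * Real.exp (-(ε ^ 2 / (ε + 2)) * n) := by
  rcases Nat.eq_zero_or_pos n with rfl | hn
  · simp
  have hn' : (0 : ℝ) < n := by exact_mod_cast hn
  set r : ℝ := A.card / n with hr
  have hr0 : 0 ≤ r := by positivity
  have hr1 : r ≤ 1 := by
    have := Finset.card_le_univ A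
    rw [Fintype.card_fin] at this
    exact div_le_one_of_le₀ (by exact_mod_cast this) hn'.le
  have hk : (K.card : ℝ) ≤ n := by
    have := Finset.card_le_univ K
    rw [Fintype.card_fin] at this
    exact_mod_cast this
  set ℓ := Real.log (1 + ε) with hℓ
  have hexp : Real.exp ℓ = 1 + ε := Real.exp_log (by linarith)
  have hℓ1 : 2 * ε / (ε + 2) ≤ ℓ := Real.le_log_one_add_of_nonneg hε.le
  have hℓ2 : ℓ ≤ ε := by
    have := Real.log_le_sub_one_of_pos (x := 1 + ε) (by linarith)
    linarith
  have hℓ0 : 0 ≤ ℓ := le_trans (by positivity) hℓ1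
  set B := Finset.univ.filter fun σ : Equiv.Perm (Fin n) =>
      (K.card * r + ε * n : ℝ) ≤ (K.filter fun p => σ p ∈ A).card with hB
  have h1 : (B.card : ℝ) * Real.exp ((K.card * r + ε * n) * ℓ) ≤
      n.factorial * Real.exp (K.card * (ε * r)) := by
    calc (B.card : ℝ) * Real.exp ((K.card * r + ε * n) * ℓ)
        = ∑ σ ∈ B, Real.exp ((K.card * r + ε * n) * ℓ) := by rw [Finset.sum_const, nsmul_eq_mul]
      _ ≤ ∑ σ ∈ B, (1 + ε) ^ (K.filter fun p => σ p ∈ A).card := by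
          refine Finset.sum_le_sum fun σ hσ => ?_
          rw [← hexp, ← Real.exp_nat_mul]
          exact Real.exp_le_exp.2 (mul_le_mul_of_nonneg_right (Finset.mem_filter.1 hσ).2 hℓ0)
      _ ≤ ∑ σ : Equiv.Perm (Fin n), (1 + ε) ^ (K.filter fun p => σ p ∈ A).card :=
          Finset.sum_le_sum_of_subset_of_nonneg (Finset.subset_univ _)
            fun σ _ _ => pow_nonneg (by linarith) _
      _ ≤ n.factorial * (1 + ε * r) ^ K.card := sum_pow_card_le K A hε.le
      _ ≤ n.factorial * Real.exp (K.card * (ε * r)) := by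
          refine mul_le_mul_of_nonneg_left ?_ (by positivity)
          rw [Real.exp_nat_mul]
          refine pow_le_pow_left₀ (by positivity) ?_ _
          rw [add_comm]
          exact Real.add_one_le_exp _
  rw [← le_div_iff₀ (Real.exp_pos _), mul_div_assoc, ← Real.exp_sub] at h1
  refine h1.trans (mul_le_mul_of_nonneg_left (Real.exp_le_exp.2 ?_) (by positivity))
  have h2 : (K.card : ℝ) * r * (ε - ℓ) ≤ n * (ε - ℓ) :=
    mul_le_mul_of_nonneg_right ((mul_le_of_le_one_right (by positivity) hr1).trans hk)
      (by linarith)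
  have h3 : ε - (1 + ε) * (2 * ε / (ε + 2)) = -(ε ^ 2 / (ε + 2)) := by
    field_simp
    ring
  have h4 : ε - (1 + ε) * ℓ ≤ -(ε ^ 2 / (ε + 2)) := by
    rw [← h3]
    have := mul_le_mul_of_nonneg_left hℓ1 (by linarith : 0 ≤ 1 + ε)
    linarith
  have h5 := mul_le_mul_of_nonneg_right h4 hn'.le
  linarith

theorem card_lower_tail_le (K A : Finset (Fin n)) {ε : ℝ} (hε : 0 < ε) :
    ((Finset.univ.filter fun σ : Equiv.Perm (Fin n) =>
      ((K.filter fun p => σ p ∈ A).card : ℝ) ≤ K.card * (A.card / n) - ε * n).card : ℝ) ≤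
      n.factorial * Real.exp (-(ε ^ 2 / (ε + 2)) * n) := by
  -- Few points landing in `A` means many landing in its complement.
  refine le_trans ?_ (card_upper_tail_le K Aᶜ hε)
  rw [Nat.cast_le]
  refine Finset.card_le_card fun σ => ?_
  simp only [Finset.mem_filter, Finset.mem_univ, true_and, Finset.mem_compl]
  intro h
  have h1 := Finset.card_filter_add_card_filter_not (s := K) (fun p => σ p ∈ A)
  rw [← @Nat.cast_inj ℝ] at h1
  push_cast at h1
  rcases Nat.eq_zero_or_pos n with rfl | hn
  · simp [Finset.eq_empty_of_isEmpty K]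
  have hn' : (0 : ℝ) < n := by exact_mod_cast hn
  have h2 : (Aᶜ.card : ℝ) / n = 1 - A.card / n := by
    have := Finset.card_add_card_compl A
    rw [Fintype.card_fin, ← @Nat.cast_inj ℝ] at this
    push_cast at this
    rw [eq_sub_iff_add_eq, ← add_div, div_eq_one_iff_eq hn'.ne']
    linarith
  rw [h2]
  linarith

/-- The permutations one of whose corner counts deviates from its mean by more than `ε n`. -/
noncomputable def deviant (n : ℕ) (ε : ℝ) : Finset (Equiv.Perm (Fin n)) :=
  Finset.univ.filter fun σ => ∃ k ≤ n, ∃ m ≤ n, ε * n < |(cornerCount σ m k : ℝ) - k * (m / n)|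

theorem card_deviant_le {ε : ℝ} (hε : 0 < ε) : ((deviant n ε).card : ℝ) ≤
    (n + 1) ^ 2 * (2 * (n.factorial * Real.exp (-(ε ^ 2 / (ε + 2)) * n))) := by
  classical
  set b := (n.factorial : ℝ) * Real.exp (-(ε ^ 2 / (ε + 2)) * n) with hb
  set I : ℕ → Finset (Fin n) := fun k => Finset.univ.filter fun p => (p : ℕ) < k with hI
  have hIc : ∀ k ≤ n, (I k).card = k := fun k hk => by
    rw [hI]
    simp only
    rw [Fin.card_filter_val_lt, min_eq_right hk]
  have hcc : ∀ (σ : Equiv.Perm (Fin n)) (m k : ℕ),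
      cornerCount σ m k = ((I k).filter fun p => σ p ∈ I m).card := by
    intro σ m k
    rw [cornerCount]
    congr 1
    ext p
    simp [hI]
  set U : ℕ × ℕ → Finset (Equiv.Perm (Fin n)) := fun q => Finset.univ.filter fun σ =>
    ((I q.1).card * ((I q.2).card / n) + ε * n : ℝ) ≤ ((I q.1).filter fun p => σ p ∈ I q.2).card
    with hU
  set V : ℕ × ℕ → Finset (Equiv.Perm (Fin n)) := fun q => Finset.univ.filter fun σ =>
    (((I q.1).filter fun p => σ p ∈ I q.2).card : ℝ) ≤
      (I q.1).card * ((I q.2).card / n) - ε * n with hV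
  have hsub : deviant n ε ⊆
      (Finset.range (n + 1) ×ˢ Finset.range (n + 1)).biUnion fun q => U q ∪ V q := by
    intro σ hσ
    obtain ⟨k, hk, m, hm, h⟩ := (Finset.mem_filter.1 hσ).2
    rw [Finset.mem_biUnion]
    refine ⟨(k, m), Finset.mem_product.2 ⟨Finset.mem_range.2 (by omega),
      Finset.mem_range.2 (by omega)⟩, ?_⟩
    rw [Finset.mem_union, hU, hV]
    simp only [Finset.mem_filter, Finset.mem_univ, true_and]
    rw [← hcc, hIc k hk, hIc m hm]
    rcases lt_abs.1 h with h | h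
    · left; linarith
    · right; linarith
  calc ((deviant n ε).card : ℝ)
      ≤ (((Finset.range (n + 1) ×ˢ Finset.range (n + 1)).biUnion fun q => U q ∪ V q).card : ℝ) := by
        exact_mod_cast Finset.card_le_card hsub
    _ ≤ ∑ q ∈ Finset.range (n + 1) ×ˢ Finset.range (n + 1), ((U q ∪ V q).card : ℝ) := by
        exact_mod_cast Finset.card_biUnion_le
    _ ≤ ∑ q ∈ Finset.range (n + 1) ×ˢ Finset.range (n + 1), 2 * b := by
        refine Finset.sum_le_sum fun q _ => ?_
        have h1 : ((U q ∪ V q).card : ℝ) ≤ (U q).card + (V q).card := by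
          exact_mod_cast Finset.card_union_le _ _
        have h2 := card_upper_tail_le (I q.1) (I q.2) hε
        have h3 := card_lower_tail_le (I q.1) (I q.2) hε
        linarith
    _ = (n + 1) ^ 2 * (2 * b) := by
        rw [Finset.sum_const, Finset.card_product, Finset.card_range, nsmul_eq_mul]
        push_cast
        ring

end Concentration

/-! ### Almost sure convergence of corner counts -/

section AlmostSure

variable {Ω : Type*} [MeasurableSpace Ω] {P : Measure Ω}

theorem IsUniformPerm.measure_preimage_le {n : ℕ} {v : Ω → Equiv.Perm (Fin n)}
    (hv : IsUniformPerm P v) (A : Finset (Equiv.Perm (Fin n))) :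
    P (v ⁻¹' A) ≤ ENNReal.ofReal (A.card / n.factorial) := by
  have h : v ⁻¹' A = ⋃ σ ∈ A, v ⁻¹' {σ} := by
    ext ω
    simp
  rw [h]
  refine (measure_biUnion_finset_le A _).trans ?_
  rw [Finset.sum_congr rfl fun σ _ => (hv σ).2, Finset.sum_const, nsmul_eq_mul,
    ENNReal.ofReal_div_of_pos (by positivity), ENNReal.ofReal_natCast, ENNReal.ofReal_natCast,
    ENNReal.div_eq_inv_mul, mul_comm]

/-- A union bound over the (n+1)² corners leaves a summable probability of deviation, so the first
Borel-Cantelli lemma applies without independence. -/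
theorem ae_eventually_cornerCount {v : ∀ n : ℕ+, Ω → Equiv.Perm (Fin n)}
    (hv : ∀ n : ℕ+, IsUniformPerm P (v n)) :
    ∀ᵐ ω ∂P, ∀ ε > 0, ∀ᶠ n : ℕ+ in atTop, ∀ k ≤ (n : ℕ), ∀ m ≤ (n : ℕ),
      |(cornerCount (v n ω) m k : ℝ) - k * (m / (n : ℕ))| ≤ ε * (n : ℕ) := by
  have h1 : ∀ ε : ℝ, 0 < ε → ∀ᵐ ω ∂P, ∀ᶠ k : ℕ in atTop,
      ω ∉ v k.succPNat ⁻¹' (deviant (k.succPNat : ℕ) ε : Set (Equiv.Perm (Fin k.succPNat))) := by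
    intro ε hε
    refine ae_eventually_notMem ?_
    set c := ε ^ 2 / (ε + 2) with hc
    have hc0 : 0 < c := by positivity
    have hsum : Summable fun k : ℕ => 8 * (((k + 1 : ℕ) : ℝ) ^ 2 *
        Real.exp (-c * ((k + 1 : ℕ) : ℝ))) :=
      ((summable_nat_add_iff 1).2 (Real.summable_pow_mul_exp_neg_nat_mul 2 hc0)).mul_left 8
    refine ne_top_of_le_ne_top hsum.tsum_ofReal_ne_top (ENNReal.tsum_le_tsum fun k => ?_)
    refine ((hv k.succPNat).measure_preimage_le _).trans (ENNReal.ofReal_le_ofReal ?_)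
    have hf : (0 : ℝ) < ((k.succPNat : ℕ).factorial : ℝ) := by positivity
    rw [div_le_iff₀ hf]
    refine (card_deviant_le hε).trans ?_
    rw [Nat.succPNat_coe, Nat.succ_eq_add_one, ← hc]
    have hk : (0 : ℝ) ≤ k := by positivity
    have hle : (((k + 1 : ℕ) : ℝ) + 1) ^ 2 ≤ 4 * ((k + 1 : ℕ) : ℝ) ^ 2 := by
      push_cast
      nlinarith
    have := mul_le_mul_of_nonneg_right hle (b := (((k + 1 : ℕ) : ℝ) + 1) ^ 2)
      (a := 2 * (((k + 1).factorial : ℝ) * Real.exp (-c * ((k + 1 : ℕ) : ℝ)))) (by positivity)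
    linarith
  -- Countably many tolerances suffice, so one null set serves all `ε`.
  have h2 : ∀ᵐ ω ∂P, ∀ q : ℕ, ∀ᶠ k : ℕ in atTop, ω ∉ v k.succPNat ⁻¹'
      (deviant (k.succPNat : ℕ) (1 / ((q : ℝ) + 1)) : Set (Equiv.Perm (Fin k.succPNat))) :=
    ae_all_iff.2 fun q => h1 _ (by positivity)
  filter_upwards [h2] with ω hω ε hε
  obtain ⟨q, hq⟩ := exists_nat_one_div_lt hε
  obtain ⟨K, hK⟩ := eventually_atTop.1 (hω q)
  filter_upwards [eventually_ge_atTop K.succPNat] with n hn k hk m hm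
  have hn1 : K ≤ n.natPred := by
    rw [← Nat.succPNat_le_succPNat, PNat.succPNat_natPred]
    exact hn
  have h := hK _ hn1
  rw [PNat.succPNat_natPred] at h
  by_contra hlt
  push Not at hlt
  refine h (Finset.mem_coe.2 (Finset.mem_filter.2 ⟨Finset.mem_univ _, k, hk, m, hm, ?_⟩))
  refine lt_of_le_of_lt (mul_le_mul_of_nonneg_right hq.le (Nat.cast_nonneg _)) hlt

end AlmostSure

/-! ### Disintegration of the limit measure along vertical lines -/

section Slices

variable {α β : ℝ}

/-- The ordinate of the southeast arc. -/
noncomputable def curveSE (α β x : ℝ) : ℝ := 1 - α / ((1 - β) * (1 - x) + α)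

/-- The ordinate of the northwest arc. -/
noncomputable def curveNW (α β x : ℝ) : ℝ := α / (β * x + α)

theorem measurable_curveSE : Measurable (curveSE α β) := by
  unfold curveSE
  fun_prop

theorem measurable_curveNW : Measurable (curveNW α β) := by
  unfold curveNW
  fun_prop

theorem measurableSet_regions : MeasurableSet (regionSE α β ∪ regionNW α β) := by
  refine MeasurableSet.union ?_ ?_
  · unfold regionSE
    measurability
  · unfold regionNW
    measurability

theorem measurableSet_arcSE : MeasurableSet (arcSE α β) := by
  unfold arcSE
  measurability

theorem measurableSet_arcNW : MeasurableSet (arcNW α β) := by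
  unfold arcNW
  measurability

theorem measurableSet_segment : MeasurableSet (segment α β) := by
  unfold segment
  measurability

theorem map_graph_prod {A : Set ℝ} (hA : MeasurableSet A) {f : ℝ → ℝ} (hf : Measurable f)
    {d : ℝ → ℝ≥0∞} {s t : Set ℝ} (hs : MeasurableSet s)
    (ht : MeasurableSet t) :
    Measure.map (fun x => (x, f x)) ((volume.restrict A).withDensity d) (s ×ˢ t) =
      ∫⁻ x in s, (A ∩ f ⁻¹' t).indicator d x := by
  have hft : MeasurableSet (f ⁻¹' t) := hf ht
  have hpre : (fun x => (x, f x)) ⁻¹' (s ×ˢ t) = s ∩ f ⁻¹' t := by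
    ext x
    simp
  rw [Measure.map_apply (by fun_prop) (hs.prod ht), hpre, withDensity_apply _ (hs.inter hft),
    Measure.restrict_restrict (hs.inter hft), lintegral_indicator (hA.inter hft),
    Measure.restrict_restrict (hA.inter hft)]
  congr 2
  ext x
  simp only [Set.mem_inter_iff]
  tauto

/-- The conditional measure of `t` on the vertical line of abscissa `x`. -/
noncomputable def sliceMass (α β x : ℝ) (t : Set ℝ) : ℝ≥0∞ :=
  volume {v | v ∈ t ∧ (x, v) ∈ regionSE α β ∪ regionNW α β}
    + (arcSE α β ∩ curveSE α β ⁻¹' t).indicator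
        (fun x => ENNReal.ofReal (α / ((1 - β) * (1 - x) + α))) x
    + (arcNW α β ∩ curveNW α β ⁻¹' t).indicator
        (fun x => ENNReal.ofReal (α / (β * x + α))) x
    + (segment α β ∩ (fun x => 1 - x) ⁻¹' t).indicator 1 x

theorem nu_prod {s t : Set ℝ} (hs : MeasurableSet s) (ht : MeasurableSet t) :
    nu α β (s ×ˢ t) = ∫⁻ x in s, sliceMass α β x t := by
  have h1 : volume.restrict (regionSE α β ∪ regionNW α β) (s ×ˢ t) =
      ∫⁻ x in s, volume {v | v ∈ t ∧ (x, v) ∈ regionSE α β ∪ regionNW α β} := by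
    rw [Measure.restrict_apply (hs.prod ht), Measure.volume_eq_prod,
      Measure.prod_apply ((hs.prod ht).inter measurableSet_regions), ← lintegral_indicator hs]
    refine lintegral_congr fun x => ?_
    by_cases hx : x ∈ s
    · rw [Set.indicator_of_mem hx]
      congr 1
      ext v
      simp [hx, and_or_left]
    · rw [Set.indicator_of_notMem hx]
      convert measure_empty (μ := (volume : Measure ℝ))
      ext v
      simp [hx]
  have h2 : ∀ {A : Set ℝ} {f : ℝ → ℝ} {d : ℝ → ℝ≥0∞}, MeasurableSet A → Measurable f →
      Measurable d → Measurable fun x => (A ∩ f ⁻¹' t).indicator d x :=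
    fun hA hf hd => hd.indicator (hA.inter (hf ht))
  have h3 := map_graph_prod (d := 1) (measurableSet_segment (α := α) (β := β))
    (f := fun x => 1 - x) (by fun_prop) hs ht
  rw [withDensity_one] at h3
  simp only [sliceMass]
  rw [lintegral_add_right _ (h2 measurableSet_segment (by fun_prop) measurable_one),
    lintegral_add_right _ (h2 measurableSet_arcNW measurable_curveNW (by fun_prop)),
    lintegral_add_right _ (h2 measurableSet_arcSE measurable_curveSE (by fun_prop)),
    ← h1, ← h3, ← map_graph_prod measurableSet_arcNW measurable_curveNW hs ht,
    ← map_graph_prod measurableSet_arcSE measurable_curveSE hs ht]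
  rfl

theorem curveSE_mem (hα : 0 < α) (hβ : β ∈ Set.Icc (0 : ℝ) 1) {x : ℝ} (hx : x ≤ 1) :
    curveSE α β x ∈ Set.Icc (0 : ℝ) 1 := by
  have h1 : 0 ≤ (1 - β) * (1 - x) := mul_nonneg (by linarith [hβ.2]) (by linarith)
  have h2 : 0 ≤ α / ((1 - β) * (1 - x) + α) := by positivity
  have h3 : α / ((1 - β) * (1 - x) + α) ≤ 1 := div_le_one_of_le₀ (by linarith) (by linarith)
  rw [curveSE]
  constructor <;> linarith

theorem curveNW_mem (hα : 0 < α) (hβ : β ∈ Set.Icc (0 : ℝ) 1) {x : ℝ} (hx : 0 ≤ x) :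
    curveNW α β x ∈ Set.Icc (0 : ℝ) 1 := by
  have h1 : 0 ≤ β * x := mul_nonneg hβ.1 hx
  exact ⟨by rw [curveNW]; positivity, div_le_one_of_le₀ (by linarith) (by linarith)⟩

theorem arcSE_subset (hα : 0 < α) (hβ : β ∈ Set.Icc (0 : ℝ) 1) : arcSE α β ⊆ Set.Icc 0 1 := by
  rintro x ⟨h1, -, h3⟩
  refine ⟨?_, h3⟩
  by_contra h
  push Not at h
  nlinarith [hβ.2]

theorem arcNW_subset (hα : 0 < α) (hβ : β ∈ Set.Icc (0 : ℝ) 1) : arcNW α β ⊆ Set.Icc 0 1 := by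
  rintro x ⟨h1, -, h3⟩
  refine ⟨h1, ?_⟩
  by_contra h
  push Not at h
  nlinarith [hβ.1]

theorem regions_subset (hα : 0 < α) (hβ : β ∈ Set.Icc (0 : ℝ) 1) :
    regionSE α β ∪ regionNW α β ⊆ Set.Icc 0 1 ×ˢ Set.Icc 0 1 := by
  rintro ⟨x, v⟩ (⟨h1, h2, h3, h4, h5, h6⟩ | ⟨h1, h2, h3, h4, h5, h6⟩)
  · simp only at *
    refine ⟨⟨?_, h2⟩, h3, by linarith [hβ.1]⟩
    by_contra h
    push Not at h
    simp only at h
    nlinarith [hβ.2]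
  · simp only at *
    refine ⟨⟨h1, ?_⟩, by linarith [hβ.2], h5⟩
    by_contra h
    push Not at h
    simp only at h
    nlinarith [hβ.1]

theorem sliceMass_of_notMem (hα : 0 < α) (hβ : β ∈ Set.Icc (0 : ℝ) 1) {x : ℝ}
    (hx : x ∉ Set.Icc (0 : ℝ) 1) (t : Set ℝ) : sliceMass α β x t = 0 := by
  have h1 : {v | v ∈ t ∧ (x, v) ∈ regionSE α β ∪ regionNW α β} = ∅ := by
    ext v
    simp only [Set.mem_ofPred_eq, Set.mem_empty_iff_false, iff_false]
    exact fun h => hx (regions_subset hα hβ h.2).1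
  rw [sliceMass, h1, measure_empty, Set.indicator_of_notMem, Set.indicator_of_notMem,
    Set.indicator_of_notMem]
  · simp
  · exact fun h => hx ⟨h.1.1, h.1.2.1⟩
  · exact fun h => hx (arcNW_subset hα hβ h.1)
  · exact fun h => hx (arcSE_subset hα hβ h.1)

theorem sliceMass_of_disjoint (hα : 0 < α) (hβ : β ∈ Set.Icc (0 : ℝ) 1) {x : ℝ} {t : Set ℝ}
    (ht : Disjoint t (Set.Icc 0 1)) : sliceMass α β x t = 0 := by
  rw [Set.disjoint_left] at ht
  have h1 : {v | v ∈ t ∧ (x, v) ∈ regionSE α β ∪ regionNW α β} = ∅ := by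
    ext v
    simp only [Set.mem_ofPred_eq, Set.mem_empty_iff_false, iff_false]
    exact fun h => ht h.1 (regions_subset hα hβ h.2).2
  rw [sliceMass, h1, measure_empty, Set.indicator_of_notMem, Set.indicator_of_notMem,
    Set.indicator_of_notMem]
  · simp
  · exact fun h => ht h.2 ⟨by linarith [h.1.2.1], by linarith [h.1.1]⟩
  · exact fun h => ht h.2 (curveNW_mem hα hβ (arcNW_subset hα hβ h.1).1)
  · exact fun h => ht h.2 (curveSE_mem hα hβ (arcSE_subset hα hβ h.1).2)

theorem nu_compl_unitSquare (hα : 0 < α) (hβ : β ∈ Set.Icc (0 : ℝ) 1) :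
    nu α β (Set.Icc (0 : ℝ) 1 ×ˢ Set.Icc (0 : ℝ) 1)ᶜ = 0 := by
  rw [Set.compl_prod_eq_union]
  refine measure_union_null ?_ ?_
  · rw [nu_prod measurableSet_Icc.compl MeasurableSet.univ]
    exact (setLIntegral_congr_fun measurableSet_Icc.compl
      fun x hx => sliceMass_of_notMem hα hβ hx _).trans lintegral_zero
  · rw [nu_prod MeasurableSet.univ measurableSet_Icc.compl]
    exact (lintegral_congr fun x => sliceMass_of_disjoint hα hβ disjoint_compl_left).trans
      lintegral_zero

open Classical in
/-- The conditional distribution function on the vertical line of abscissa `x`. -/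
noncomputable def sliceCDF (α β y x : ℝ) : ℝ :=
  if α < (1 - β) * x then
    if α < β * (1 - x) then y else if y < curveSE α β x then y else 1
  else
    if α < β * (1 - x) then if y < curveNW α β x then 0 else y else if 1 - x ≤ y then 1 else 0

theorem measurable_sliceCDF (y : ℝ) : Measurable (sliceCDF α β y) := by
  unfold sliceCDF
  refine Measurable.ite (measurableSet_lt (by fun_prop) (by fun_prop)) ?_ ?_
  · refine Measurable.ite (measurableSet_lt (by fun_prop) (by fun_prop)) (by fun_prop) ?_
    exact Measurable.ite (measurableSet_lt (by fun_prop) measurable_curveSE) (by fun_prop)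
      (by fun_prop)
  · refine Measurable.ite (measurableSet_lt (by fun_prop) (by fun_prop)) ?_ ?_
    · exact Measurable.ite (measurableSet_lt (by fun_prop) measurable_curveNW) (by fun_prop)
        (by fun_prop)
    · exact Measurable.ite (measurableSet_le (by fun_prop) (by fun_prop)) (by fun_prop)
        (by fun_prop)

theorem sliceCDF_mem {y : ℝ} (hy : y ∈ Set.Icc (0 : ℝ) 1) (x : ℝ) :
    sliceCDF α β y x ∈ Set.Icc (0 : ℝ) 1 := by
  unfold sliceCDF
  split_ifs <;> first | exact hy | simp

/-- If both strict inequalities hold, the regions fill the vertical line with Lebesgue measure. If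
only the first holds, there is Lebesgue measure up to the southeast arc and an atom there with the
remaining mass; if only the second, an atom on the northwest arc and Lebesgue measure above it. If
neither holds, a unit atom sits at 1-x. The excluded abscissas are those where closed pieces
overlap. -/
theorem sliceMass_Iic (hα : 0 < α) (hβ : β ∈ Set.Icc (0 : ℝ) 1) {x y : ℝ}
    (hx : x ∈ Set.Ioo (0 : ℝ) 1) (hy : y ∈ Set.Icc (0 : ℝ) 1) (h1 : (1 - β) * x ≠ α)
    (h2 : β * (1 - x) ≠ α) :
    sliceMass α β x (Set.Iic y) = ENNReal.ofReal (sliceCDF α β y x) := by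
  have hb' : 0 ≤ 1 - β := by linarith [hβ.2]
  have hx' : 0 < 1 - x := by linarith [hx.2]
  have hd1 : 0 < (1 - β) * (1 - x) + α := by nlinarith
  have hd2 : 0 < β * x + α := by nlinarith [hβ.1, hx.1]
  have hSE := curveSE_mem hα hβ hx.2.le
  have hNW := curveNW_mem hα hβ hx.1.le
  rw [sliceMass, sliceCDF]
  by_cases a : α < (1 - β) * x <;> by_cases b : α < β * (1 - x)
  · have hm : {v | v ∈ Set.Iic y ∧ (x, v) ∈ regionSE α β ∪ regionNW α β} = Set.Icc 0 y := by
      ext v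
      constructor
      · rintro ⟨hv, hr⟩
        exact ⟨(regions_subset hα hβ hr).2.1, hv⟩
      · rintro ⟨hv0, hv⟩
        refine ⟨hv, ?_⟩
        have hβ0 : 0 < β := hβ.1.lt_of_ne (by rintro rfl; linarith)
        have hβ1 : 0 < 1 - β := hb'.lt_of_ne (by intro h; rw [← h] at a; linarith)
        -- Average the two case hypotheses with weights β and 1-β.
        have hββ : α ≤ β * (1 - β) := by nlinarith
        rcases le_total v (1 - β) with hvb | hvb
        · left
          refine ⟨a.le, hx.2.le, hv0, hvb, by nlinarith, ?_⟩
          simp only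
          rw [le_sub_comm, div_le_iff₀ hd1]
          nlinarith [mul_nonneg hβ0.le hβ1.le, mul_pos hx' hβ1]
        · right
          refine ⟨hx.1.le, b.le, hvb, by nlinarith, hv.trans hy.2, ?_⟩
          simp only
          rw [div_le_iff₀ hd2]
          nlinarith [mul_pos hβ0 hx.1]
    rw [hm, if_pos a, if_pos b, Real.volume_Icc, Set.indicator_of_notMem, Set.indicator_of_notMem,
      Set.indicator_of_notMem]
    · simp
    · exact fun h => absurd h.1.2.2.2 (not_le.2 a)
    · exact fun h => absurd h.1.2.1 (not_le.2 a)
    · exact fun h => absurd h.1.2.1 (not_le.2 b)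
  · have b' : β * (1 - x) < α := lt_of_le_of_ne (not_lt.1 b) h2
    have hβ1 : 0 < 1 - β := hb'.lt_of_ne (by intro h; rw [← h] at a; linarith)
    have hm : {v | v ∈ Set.Iic y ∧ (x, v) ∈ regionSE α β ∪ regionNW α β} =
        Set.Icc 0 (min y (curveSE α β x)) := by
      ext v
      constructor
      · rintro ⟨hv, hr | hr⟩
        · exact ⟨hr.2.2.1, le_min hv hr.2.2.2.2.2⟩
        · exact absurd hr.2.1 (not_le.2 b')
      · rintro ⟨hv0, hv⟩
        refine ⟨hv.trans (min_le_left _ _), Or.inl ?_⟩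
        have hv2 : v ≤ curveSE α β x := hv.trans (min_le_right _ _)
        have hv3 : α ≤ (1 - v) * ((1 - β) * (1 - x) + α) := by
          rw [curveSE, le_sub_comm, div_le_iff₀ hd1] at hv2
          exact hv2
        -- Since β(1-x) < α, the arc lies at height at most 1-β, so the horizontal cutoff of the
        -- region is automatic.
        have e1 : v * ((1 - β) * (1 - x) + α) ≤ (1 - β) * ((1 - β) * (1 - x) + α) := by
          nlinarith
        exact ⟨a.le, hx.2.le, hv0, le_of_mul_le_mul_right e1 hd1, by
          simp only
          nlinarith, hv2⟩
    rw [hm, if_pos a, if_neg b, Real.volume_Icc,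
      Set.indicator_of_notMem (s := arcNW α β ∩ _), Set.indicator_of_notMem (s := segment α β ∩ _),
      add_zero, add_zero, sub_zero]
    · by_cases hyc : y < curveSE α β x
      · rw [if_pos hyc, Set.indicator_of_notMem, add_zero, min_eq_left hyc.le]
        exact fun h => absurd h.2 (not_le.2 hyc)
      · rw [if_neg hyc, Set.indicator_of_mem (s := arcSE α β ∩ curveSE α β ⁻¹' Set.Iic y)
          ⟨⟨a.le, b'.le, hx.2.le⟩, not_lt.1 hyc⟩,
          min_eq_right (not_lt.1 hyc), ← ENNReal.ofReal_add hSE.1 (by positivity), curveSE]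
        congr 1
        ring
    · exact fun h => absurd h.1.2.2.2 (not_le.2 a)
    · exact fun h => absurd h.1.2.1 (not_le.2 a)
  · have a' : (1 - β) * x < α := lt_of_le_of_ne (not_lt.1 a) h1
    have hβ0 : 0 < β := hβ.1.lt_of_ne (by rintro rfl; linarith)
    have hm : {v | v ∈ Set.Iic y ∧ (x, v) ∈ regionSE α β ∪ regionNW α β} =
        Set.Icc (curveNW α β x) y := by
      ext v
      constructor
      · rintro ⟨hv, hr | hr⟩
        · exact absurd hr.1 (not_le.2 a')
        · exact ⟨hr.2.2.2.2.2, hv⟩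
      · rintro ⟨hv2, hv⟩
        refine ⟨hv, Or.inr ?_⟩
        have hv3 : α ≤ v * (β * x + α) := by
          rw [curveNW, div_le_iff₀ hd2] at hv2
          exact hv2
        -- Since (1-β)x < α, the arc lies at height at least 1-β, so the cutoff is again automatic.
        have e1 : (1 - β) * (β * x + α) ≤ v * (β * x + α) := by nlinarith
        exact ⟨hx.1.le, b.le, le_of_mul_le_mul_right e1 hd2, by
          simp only
          nlinarith, hv.trans hy.2, hv2⟩
    rw [hm, if_neg a, if_pos b, Real.volume_Icc,
      Set.indicator_of_notMem (s := arcSE α β ∩ _), Set.indicator_of_notMem (s := segment α β ∩ _),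
      add_zero, add_zero]
    · by_cases hyc : y < curveNW α β x
      · rw [if_pos hyc, Set.indicator_of_notMem, add_zero, ENNReal.ofReal_of_nonpos (by linarith),
          ENNReal.ofReal_zero]
        exact fun h => absurd h.2 (not_le.2 hyc)
      · have hyc' := not_lt.1 hyc
        rw [if_neg hyc, Set.indicator_of_mem (s := arcNW α β ∩ curveNW α β ⁻¹' Set.Iic y)
          ⟨⟨hx.1.le, a'.le, b.le⟩, hyc'⟩,
          ← ENNReal.ofReal_add (by linarith) (by positivity), curveNW]
        congr 1
        ring
    · exact fun h => absurd h.1.2.2.1 (not_le.2 b)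
    · exact fun h => absurd h.1.2.1 (not_le.2 b)
  · have a' : (1 - β) * x < α := lt_of_le_of_ne (not_lt.1 a) h1
    have b' : β * (1 - x) < α := lt_of_le_of_ne (not_lt.1 b) h2
    have hm : {v | v ∈ Set.Iic y ∧ (x, v) ∈ regionSE α β ∪ regionNW α β} = ∅ := by
      ext v
      simp only [Set.mem_ofPred_eq, Set.mem_empty_iff_false, iff_false]
      rintro ⟨-, hr | hr⟩
      · exact absurd hr.1 (not_le.2 a')
      · exact absurd hr.2.1 (not_le.2 b')
    rw [hm, if_neg a, if_neg b, measure_empty, Set.indicator_of_notMem (s := arcSE α β ∩ _),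
      Set.indicator_of_notMem (s := arcNW α β ∩ _), add_zero, add_zero, zero_add]
    · by_cases hyc : 1 - x ≤ y
      · rw [if_pos hyc, Set.indicator_of_mem (s := segment α β ∩ (fun x => 1 - x) ⁻¹' Set.Iic y)
          ⟨⟨hx.1.le, hx.2.le, b'.le, a'.le⟩, hyc⟩]
        simp
      · rw [if_neg hyc, Set.indicator_of_notMem]
        · simp
        · exact fun h => hyc h.2
    · exact fun h => absurd h.1.2.2 (not_le.2 b')
    · exact fun h => absurd h.1.1 (not_le.2 a')

end Slices

/-! ### The distribution function of the limit measure -/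

section CDF

variable {α β x y : ℝ}

theorem tent_spec (β : ℝ) (hy : y ∈ Set.Ioo (0 : ℝ) 1) :
    0 < tent β y ∧ tent β y * (1 - β) ≤ y ∧ tent β y * β ≤ 1 - y ∧
      (tent β y * (1 - β) = y ∨ tent β y * β = 1 - y) := by
  obtain ⟨hy0, hy1⟩ := hy
  rw [tent]
  split_ifs with h
  · have hb : 0 < 1 - β := by linarith
    have e : y / (1 - β) * (1 - β) = y := div_mul_cancel₀ _ hb.ne'
    refine ⟨div_pos hy0 hb, e.le, ?_, Or.inl e⟩
    rw [div_mul_eq_mul_div, div_le_iff₀ hb]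
    nlinarith
  · push Not at h
    have hb : 0 < β := by linarith
    have e : (1 - y) / β * β = 1 - y := div_mul_cancel₀ _ hb.ne'
    refine ⟨div_pos (by linarith) hb, ?_, e.le, Or.inr e⟩
    rw [div_mul_eq_mul_div, div_le_iff₀ hb]
    nlinarith

theorem hasDerivAt_limitCDF_of_lt_of_lt (h1 : x * y - α * tent β y < 0) (h2 : x + y < 1) :
    HasDerivAt (fun z => limitCDF α β z y) 0 x := by
  refine (hasDerivAt_const x (0 : ℝ)).congr_of_eventuallyEq ?_
  have e1 : ∀ᶠ z in 𝓝 x, z * y - α * tent β y < 0 :=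
    (by fun_prop : ContinuousAt (fun z => z * y - α * tent β y) x).eventually_lt_const h1
  have e2 : ∀ᶠ z in 𝓝 x, z + y < 1 :=
    (by fun_prop : ContinuousAt (fun z => z + y) x).eventually_lt_const h2
  filter_upwards [e1, e2] with z h1 h2
  exact max_eq_left (max_le (by linarith) h1.le)

theorem hasDerivAt_limitCDF_linear (h1 : 0 < x + y - 1)
    (h2 : x * y - α * tent β y < x + y - 1) :
    HasDerivAt (fun z => limitCDF α β z y) 1 x := by
  refine (((hasDerivAt_id x).add_const (y - 1))).congr_of_eventuallyEq ?_
  have e1 : ∀ᶠ z in 𝓝 x, 0 < z + y - 1 :=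
    (by fun_prop : ContinuousAt (fun z => z + y - 1) x).eventually_const_lt h1
  have e2 : ∀ᶠ z in 𝓝 x, z * y - α * tent β y < z + y - 1 :=
    ContinuousAt.eventually_lt (by fun_prop) (by fun_prop) h2
  filter_upwards [e1, e2] with z h1 h2
  rw [limitCDF, max_eq_left h2.le, max_eq_right h1.le, id]
  ring

theorem hasDerivAt_limitCDF_product (h1 : 0 < x * y - α * tent β y)
    (h2 : x + y - 1 < x * y - α * tent β y) :
    HasDerivAt (fun z => limitCDF α β z y) y x := by
  have h := ((hasDerivAt_id x).mul_const y).sub_const (α * tent β y)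
  rw [one_mul] at h
  refine h.congr_of_eventuallyEq ?_
  have e1 : ∀ᶠ z in 𝓝 x, 0 < z * y - α * tent β y :=
    (by fun_prop : ContinuousAt (fun z => z * y - α * tent β y) x).eventually_const_lt h1
  have e2 : ∀ᶠ z in 𝓝 x, z + y - 1 < z * y - α * tent β y :=
    ContinuousAt.eventually_lt (by fun_prop) (by fun_prop) h2
  filter_upwards [e1, e2] with z h1 h2
  rw [limitCDF, max_eq_right h2.le, max_eq_right h1.le, id]

/-- With c = `tent β y`, the product term beats 0 iff αc < xy, and beats x+y-1 iff αc < (1-x)(1-y).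
The case hypotheses of `sliceCDF` decide these comparisons through `tent_spec`; the arcs and the
anti-diagonal are where the dominant term changes. Away from ties it dominates in a neighbourhood,
so its slope in z is the derivative. -/
theorem hasDerivAt_limitCDF (hα : 0 < α) (hβ : β ∈ Set.Icc (0 : ℝ) 1)
    (hx : x ∈ Set.Ioo (0 : ℝ) 1) (hy : y ∈ Set.Ioo (0 : ℝ) 1) (h1 : (1 - β) * x ≠ α)
    (h2 : β * (1 - x) ≠ α) (h3 : x + y ≠ 1)
    (h4 : α < (1 - β) * x → (1 - y) * ((1 - β) * (1 - x) + α) ≠ α)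
    (h5 : α < β * (1 - x) → y * (β * x + α) ≠ α) :
    HasDerivAt (fun z => limitCDF α β z y) (sliceCDF α β y x) x := by
  obtain ⟨hc0, hc1, hc2, hc3⟩ := tent_spec β hy
  obtain ⟨hy0, hy1⟩ := hy
  obtain ⟨hx0, hx1⟩ := hx
  have hβ0 := hβ.1
  have hb' : 0 ≤ 1 - β := by linarith [hβ.2]
  set c := tent β y with hc
  have hx' : 0 < 1 - x := by linarith
  have hy' : 0 < 1 - y := by linarith
  have hαc : 0 < α * c := mul_pos hα hc0
  have hd1 : 0 < (1 - β) * (1 - x) + α := by nlinarith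
  have hd2 : 0 < β * x + α := by nlinarith
  rw [sliceCDF]
  by_cases a : α < (1 - β) * x <;> by_cases b : α < β * (1 - x)
  · rw [if_pos a, if_pos b]
    have e1 : α * c < x * y := by nlinarith
    have e2 : α * c < (1 - x) * (1 - y) := by nlinarith
    exact hasDerivAt_limitCDF_product (by linarith) (by linarith)
  · have b' : β * (1 - x) < α := lt_of_le_of_ne (not_lt.1 b) h2
    have hβ1 : 0 < 1 - β := hb'.lt_of_ne (by intro h; rw [← h] at a; linarith)
    have e1 : α * c < x * y := by nlinarith
    rw [if_pos a, if_neg b]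
    split_ifs with hlt
    · rw [curveSE, lt_sub_comm, div_lt_iff₀ hd1] at hlt
      have e2 : α * c < (1 - x) * (1 - y) := by
        refine lt_of_mul_lt_mul_right ?_ hβ1.le
        nlinarith
      exact hasDerivAt_limitCDF_product (by linarith) (by linarith)
    · rw [curveSE, lt_sub_comm, div_lt_iff₀ hd1] at hlt
      have hlt' := lt_of_le_of_ne (not_lt.1 hlt) (h4 a)
      have e2 : (1 - x) * (1 - y) < α * c := by
        rcases hc3 with hc3 | hc3
        · refine lt_of_mul_lt_mul_right ?_ hβ1.le
          nlinarith
        · refine lt_of_mul_lt_mul_right ?_ hβ0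
          nlinarith
      exact hasDerivAt_limitCDF_linear (by linarith) (by linarith)
  · have a' : (1 - β) * x < α := lt_of_le_of_ne (not_lt.1 a) h1
    have hβ0' : 0 < β := hβ0.lt_of_ne (by rintro rfl; linarith)
    have e2 : α * c < (1 - x) * (1 - y) := by nlinarith
    rw [if_neg a, if_pos b]
    split_ifs with hlt
    · rw [curveNW, lt_div_iff₀ hd2] at hlt
      have e1 : x * y < α * c := by
        rcases hc3 with hc3 | hc3
        · refine lt_of_mul_lt_mul_right ?_ hb'
          nlinarith
        · refine lt_of_mul_lt_mul_right ?_ hβ0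
          nlinarith
      exact hasDerivAt_limitCDF_of_lt_of_lt (by linarith) (by linarith)
    · rw [curveNW, lt_div_iff₀ hd2] at hlt
      have hlt' := lt_of_le_of_ne (not_lt.1 hlt) (h5 b).symm
      have e1 : α * c < x * y := by
        refine lt_of_mul_lt_mul_right ?_ hβ0
        nlinarith
      exact hasDerivAt_limitCDF_product (by linarith) (by linarith)
  · have a' : (1 - β) * x < α := lt_of_le_of_ne (not_lt.1 a) h1
    have b' : β * (1 - x) < α := lt_of_le_of_ne (not_lt.1 b) h2
    rw [if_neg a, if_neg b]
    split_ifs with hlt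
    · have hlt' : 1 < x + y := lt_of_le_of_ne (by linarith) h3.symm
      have e2 : (1 - x) * (1 - y) < α * c := by
        rcases hc3 with hc3 | hc3
        · refine lt_of_mul_lt_mul_right ?_ hb'
          nlinarith
        · refine lt_of_mul_lt_mul_right ?_ hβ0
          nlinarith
      exact hasDerivAt_limitCDF_linear (by linarith) (by linarith)
    · have e1 : x * y < α * c := by
        rcases hc3 with hc3 | hc3
        · refine lt_of_mul_lt_mul_right ?_ hb'
          nlinarith
        · refine lt_of_mul_lt_mul_right ?_ hβ0
          nlinarith
      exact hasDerivAt_limitCDF_of_lt_of_lt (by linarith) (by linarith)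

theorem countable_setOf_affine_eq {a b d : ℝ} (h : a ≠ 0 ∨ b ≠ d) :
    {x : ℝ | a * x + b = d}.Countable := by
  refine Set.Subsingleton.countable fun x hx z hz => ?_
  simp only [Set.mem_ofPred_eq] at hx hz
  rcases eq_or_ne a 0 with rfl | ha
  · exact absurd (by linarith) (h.resolve_left fun h => h rfl)
  · exact mul_left_cancel₀ ha (by linarith)

/-- The abscissas excluded in `sliceMass_Iic` and `hasDerivAt_limitCDF`. -/
def exceptional (α β y : ℝ) : Set ℝ :=
  {x | (1 - β) * x = α} ∪ {x | β * (1 - x) = α} ∪ {x | x + y = 1} ∪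
    {x | α < (1 - β) * x ∧ (1 - y) * ((1 - β) * (1 - x) + α) = α} ∪
    {x | α < β * (1 - x) ∧ y * (β * x + α) = α}

theorem countable_exceptional (hα : 0 < α) (hy : y ∈ Set.Ioo (0 : ℝ) 1) :
    (exceptional α β y).Countable := by
  refine ((((Set.Countable.union ?_ ?_).union ?_).union ?_).union ?_)
  · exact (countable_setOf_affine_eq (a := 1 - β) (b := 0) (d := α) (Or.inr hα.ne)).mono
      fun x hx => by simpa using hx
  · refine (countable_setOf_affine_eq (a := -β) (b := β) (d := α) ?_).mono fun x hx => ?_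
    · rcases eq_or_ne β 0 with rfl | h
      · exact Or.inr hα.ne
      · exact Or.inl (neg_ne_zero.2 h)
    · simp only [Set.mem_ofPred_eq] at hx ⊢
      linarith
  · exact (countable_setOf_affine_eq (a := 1) (b := y) (d := 1) (Or.inl one_ne_zero)).mono
      fun x hx => by simpa using hx
  · rcases eq_or_ne (1 - β) 0 with h | h
    · refine Set.countable_empty.mono fun x hx => ?_
      have := hx.1
      rw [h, zero_mul] at this
      exact absurd this (not_lt.2 hα.le)
    · refine (countable_setOf_affine_eq (a := -((1 - y) * (1 - β)))
        (b := (1 - y) * (1 - β) + (1 - y) * α) (d := α) (Or.inl ?_)).mono fun x hx => ?_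
      · exact neg_ne_zero.2 (mul_ne_zero (by linarith [hy.2]) h)
      · have := hx.2
        simp only [Set.mem_ofPred_eq]
        linarith
  · rcases eq_or_ne β 0 with h | h
    · refine Set.countable_empty.mono fun x hx => ?_
      have := hx.1
      rw [h, zero_mul] at this
      exact absurd this (not_lt.2 hα.le)
    · refine (countable_setOf_affine_eq (a := y * β) (b := y * α) (d := α) (Or.inl ?_)).mono
        fun x hx => ?_
      · exact mul_ne_zero hy.1.ne' h
      · have := hx.2
        simp only [Set.mem_ofPred_eq]
        linarith

theorem continuous_limitCDF : Continuous fun z => limitCDF α β z y := by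
  unfold limitCDF
  fun_prop

theorem limitCDF_zero_left (hα : 0 < α) (hy : y ∈ Set.Ioo (0 : ℝ) 1) :
    limitCDF α β 0 y = 0 := by
  have := mul_pos hα (tent_spec β hy).1
  exact max_eq_left (max_le (by linarith [hy.2]) (by linarith))

theorem tent_nonneg (hβ : β ∈ Set.Icc (0 : ℝ) 1) (hy : y ∈ Set.Icc (0 : ℝ) 1) :
    0 ≤ tent β y := by
  rw [tent]
  split_ifs
  · exact div_nonneg hy.1 (by linarith [hβ.2])
  · exact div_nonneg (by linarith [hy.2]) hβ.1

theorem limitCDF_one_left (hα : 0 < α) (hβ : β ∈ Set.Icc (0 : ℝ) 1)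
    (hy : y ∈ Set.Icc (0 : ℝ) 1) : limitCDF α β 1 y = y := by
  have := mul_nonneg hα.le (tent_nonneg hβ hy)
  rw [limitCDF, max_eq_left (by linarith : 1 * y - α * tent β y ≤ 1 + y - 1), add_sub_cancel_left,
    max_eq_right hy.1]

theorem limitCDF_one_right (hα : 0 < α) (hβ : β ∈ Set.Icc (0 : ℝ) 1)
    (hx : x ∈ Set.Icc (0 : ℝ) 1) : limitCDF α β x 1 = x := by
  have := mul_nonneg hα.le (tent_nonneg hβ (by simp : (1 : ℝ) ∈ Set.Icc (0 : ℝ) 1))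
  rw [limitCDF, max_eq_left (by linarith : x * 1 - α * tent β 1 ≤ x + 1 - 1), add_sub_cancel_right,
    max_eq_right hx.1]

theorem limitCDF_zero_right (hβ : β ∈ Set.Icc (0 : ℝ) 1) (hx : x ∈ Set.Icc (0 : ℝ) 1) :
    limitCDF α β x 0 = 0 := by
  have h : tent β 0 = 0 := by
    rw [tent, if_pos (by linarith [hβ.2]), zero_div]
  rw [limitCDF, h]
  exact max_eq_left (max_le (by linarith [hx.2]) (by simp))

theorem integrableOn_sliceCDF (hy : y ∈ Set.Icc (0 : ℝ) 1) (a b : ℝ) :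
    IntegrableOn (sliceCDF α β y) (Set.Ioc a b) := by
  refine Measure.integrableOn_of_bounded (M := 1) (by simp)
    (measurable_sliceCDF y).aestronglyMeasurable (Eventually.of_forall fun x => ?_)
  have := sliceCDF_mem (α := α) (β := β) hy x
  rw [Real.norm_eq_abs, abs_of_nonneg this.1]
  exact this.2

theorem nu_Iic_prod_Iic_eq_integral (hα : 0 < α) (hβ : β ∈ Set.Icc (0 : ℝ) 1)
    (hx : x ∈ Set.Icc (0 : ℝ) 1) (hy : y ∈ Set.Icc (0 : ℝ) 1) :
    nu α β (Set.Iic x ×ˢ Set.Iic y) = ENNReal.ofReal (∫ s in Set.Ioo 0 x, sliceCDF α β y s) := by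
  have h0 : ∫⁻ s in Set.Iic 0, sliceMass α β s (Set.Iic y) = 0 := by
    rw [setLIntegral_congr Iio_ae_eq_Iic.symm]
    exact (setLIntegral_congr_fun measurableSet_Iio fun s hs =>
      sliceMass_of_notMem hα hβ (fun h => not_le.2 hs h.1) _).trans lintegral_zero
  rw [nu_prod measurableSet_Iic measurableSet_Iic, ← Set.Iic_union_Ioc_eq_Iic hx.1,
    lintegral_union measurableSet_Ioc (Set.Iic_disjoint_Ioc le_rfl), h0, zero_add,
    setLIntegral_congr Ioo_ae_eq_Ioc.symm, ofReal_integral_eq_lintegral_ofReal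
      ((integrableOn_sliceCDF hy 0 x).mono_set Set.Ioo_subset_Ioc_self)
      (Eventually.of_forall fun s => (sliceCDF_mem hy s).1)]
  have hcount : ({s : ℝ | (1 - β) * s + 0 = α} ∪ {s : ℝ | -β * s + β = α}).Countable := by
    refine (countable_setOf_affine_eq (Or.inr hα.ne)).union (countable_setOf_affine_eq ?_)
    rcases eq_or_ne β 0 with rfl | h
    · exact Or.inr hα.ne
    · exact Or.inl (neg_ne_zero.2 h)
  refine setLIntegral_congr_fun_ae measurableSet_Ioo ?_
  filter_upwards [hcount.ae_notMem volume] with s hs hs01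
  refine sliceMass_Iic hα hβ ⟨hs01.1, hs01.2.trans_le hx.2⟩ hy ?_ ?_
  · exact fun h => hs (Or.inl (by simpa using h))
  · refine fun h => hs (Or.inr ?_)
    simp only [Set.mem_ofPred_eq]
    linarith

/-- Integrate the slices: the limit function is continuous in z, vanishes at z = 0, and has
derivative `sliceCDF` off a countable set. The edges y = 0 and y = 1 are computed directly, because
the derivative statement needs 0 < y < 1. -/
theorem nu_Iic_prod_Iic (hα : 0 < α) (hβ : β ∈ Set.Icc (0 : ℝ) 1)
    (hx : x ∈ Set.Icc (0 : ℝ) 1) (hy : y ∈ Set.Icc (0 : ℝ) 1) :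
    nu α β (Set.Iic x ×ˢ Set.Iic y) = ENNReal.ofReal (limitCDF α β x y) := by
  rw [nu_Iic_prod_Iic_eq_integral hα hβ hx hy]
  congr 1
  rcases hy.1.eq_or_lt with rfl | hy0
  · rw [limitCDF_zero_right hβ hx]
    refine setIntegral_eq_zero_of_forall_eq_zero fun s hs => ?_
    have hs' : 0 < 1 - s := by linarith [hs.2, hx.2]
    have hb' : 0 ≤ 1 - β := by linarith [hβ.2]
    rw [sliceCDF]
    split_ifs with h1 h2 h3 h4 h5 h6
    · rfl
    · rfl
    · refine absurd ?_ h3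
      have hβ1 : 0 < 1 - β := hb'.lt_of_ne (by intro h; rw [← h] at h1; linarith)
      have := mul_pos hβ1 hs'
      rw [curveSE, sub_pos, div_lt_one (by linarith)]
      linarith
    · rfl
    · rfl
    · linarith
    · rfl
  rcases hy.2.eq_or_lt with rfl | hy1
  · rw [limitCDF_one_right hα hβ hx]
    have h : ∀ s ∈ Set.Ioo 0 x, sliceCDF α β 1 s = 1 := by
      intro s hs
      have h1 := (curveSE_mem hα hβ (hs.2.le.trans hx.2)).2
      have h2 := (curveNW_mem hα hβ hs.1.le).2
      rw [sliceCDF, if_neg (not_lt.2 h1), if_neg (not_lt.2 h2), if_pos (show 1 - s ≤ 1 by linarith [hs.1])]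
      simp
    rw [setIntegral_congr_fun measurableSet_Ioo h]
    simp [hx.1]
  · have hint : IntervalIntegrable (sliceCDF α β y) volume 0 x := by
      rw [intervalIntegrable_iff_integrableOn_Ioc_of_le hx.1]
      exact integrableOn_sliceCDF hy 0 x
    have hint' := integral_eq_of_hasDerivAt_off_countable_of_le (fun z => limitCDF α β z y)
      (sliceCDF α β y) hx.1 (countable_exceptional (β := β) hα ⟨hy0, hy1⟩)
      continuous_limitCDF.continuousOn (fun s hs => by
        obtain ⟨hs, hse⟩ := hs
        simp only [exceptional, Set.mem_union, Set.mem_ofPred_eq, not_or, not_and] at hse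
        obtain ⟨⟨⟨⟨h1, h2⟩, h3⟩, h4⟩, h5⟩ := hse
        exact hasDerivAt_limitCDF hα hβ ⟨hs.1, hs.2.trans_le hx.2⟩ ⟨hy0, hy1⟩ h1 h2 h3 h4 h5) hint
    rw [← integral_Ioc_eq_integral_Ioo, ← intervalIntegral.integral_of_le hx.1, hint',
      limitCDF_zero_left hα ⟨hy0, hy1⟩, sub_zero]

end CDF

/-! ### Permutons from distribution functions -/

section Permuton

variable {μ : Measure (ℝ × ℝ)}

theorem measure_inter_unitSquare (h : μ (Set.Icc (0 : ℝ) 1 ×ˢ Set.Icc (0 : ℝ) 1)ᶜ = 0)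
    {s t : Set (ℝ × ℝ)} (hst : ∀ p ∈ Set.Icc (0 : ℝ) 1 ×ˢ Set.Icc (0 : ℝ) 1, p ∈ s ↔ p ∈ t) :
    μ s = μ t := by
  refine measure_congr ?_
  filter_upwards [compl_mem_ae_iff.2 h] with p hp
  rw [compl_compl] at hp
  exact propext (hst p hp)

theorem eq_restrict_of_Iic {ρ : Measure ℝ} [IsFiniteMeasure ρ] (h0 : ∀ a < 0, ρ (Set.Iic a) = 0)
    (h : ∀ a ∈ Set.Icc (0 : ℝ) 1, ρ (Set.Iic a) = ENNReal.ofReal a)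
    (h1 : ∀ a > 1, ρ (Set.Iic a) = 1) : ρ = volume.restrict (Set.Icc 0 1) := by
  refine Measure.ext_of_Iic _ _ fun a => ?_
  rw [Measure.restrict_apply measurableSet_Iic]
  rcases lt_or_ge a 0 with ha | ha
  · rw [h0 a ha, Set.disjoint_iff_inter_eq_empty.1, measure_empty]
    exact Set.disjoint_left.2 fun x hx hx' => absurd (hx'.1.trans hx) (not_le.2 ha)
  rcases le_or_gt a 1 with ha1 | ha1
  · have : Set.Iic a ∩ Set.Icc 0 1 = Set.Icc 0 a := by
      ext x
      simp only [Set.mem_inter_iff, Set.mem_Iic, Set.mem_Icc]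
      constructor
      · exact fun h => ⟨h.2.1, h.1⟩
      · exact fun h => ⟨h.2, h.1, h.2.trans ha1⟩
    rw [h a ⟨ha, ha1⟩, this, Real.volume_Icc, sub_zero]
  · rw [h1 a ha1, Set.inter_eq_right.2 fun x hx => hx.2.trans ha1.le, Real.volume_Icc]
    simp

theorem isPermuton_of_Iic (h : μ (Set.Icc (0 : ℝ) 1 ×ˢ Set.Icc (0 : ℝ) 1)ᶜ = 0)
    (h1 : ∀ a ∈ Set.Icc (0 : ℝ) 1, μ (Set.Iic a ×ˢ Set.Iic 1) = ENNReal.ofReal a)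
    (h2 : ∀ a ∈ Set.Icc (0 : ℝ) 1, μ (Set.Iic 1 ×ˢ Set.Iic a) = ENNReal.ofReal a) :
    IsPermuton μ := by
  have hone : μ Set.univ = 1 := by
    rw [← ENNReal.ofReal_one, ← h1 1 (by simp)]
    refine measure_inter_unitSquare h fun p hp => ?_
    simp [-Set.Iic_prod_Iic, hp.1.2, hp.2.2]
  have hprob : IsProbabilityMeasure μ := ⟨hone⟩
  have hfst : μ.map Prod.fst = volume.restrict (Set.Icc 0 1) := by
    refine eq_restrict_of_Iic (fun a ha => ?_) (fun a ha => ?_) fun a ha => ?_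
    all_goals rw [Measure.map_apply measurable_fst measurableSet_Iic]
    · rw [← measure_empty (μ := μ)]
      refine measure_inter_unitSquare h fun p hp => ?_
      simp only [Set.mem_preimage, Set.mem_Iic, Set.mem_empty_iff_false, iff_false, not_le]
      exact ha.trans_le hp.1.1
    · rw [← h1 a ha]
      refine measure_inter_unitSquare h fun p hp => ?_
      simp [-Set.Iic_prod_Iic, hp.2.2]
    · rw [← hone]
      refine measure_inter_unitSquare h fun p hp => ?_
      simp [hp.1.2.trans ha.le]
  have hsnd : μ.map Prod.snd = volume.restrict (Set.Icc 0 1) := by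
    refine eq_restrict_of_Iic (fun a ha => ?_) (fun a ha => ?_) fun a ha => ?_
    all_goals rw [Measure.map_apply measurable_snd measurableSet_Iic]
    · rw [← measure_empty (μ := μ)]
      refine measure_inter_unitSquare h fun p hp => ?_
      simp only [Set.mem_preimage, Set.mem_Iic, Set.mem_empty_iff_false, iff_false, not_le]
      exact ha.trans_le hp.2.1
    · rw [← h2 a ha]
      refine measure_inter_unitSquare h fun p hp => ?_
      simp [-Set.Iic_prod_Iic, hp.1.2]
    · rw [← hone]
      refine measure_inter_unitSquare h fun p hp => ?_
      simp [hp.2.2.trans ha.le]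
  have hIcc : ∀ a b : ℝ, 0 ≤ a → b ≤ 1 →
      volume.restrict (Set.Icc (0 : ℝ) 1) (Set.Icc a b) = ENNReal.ofReal (b - a) := by
    intro a b ha hb
    rw [Measure.restrict_apply measurableSet_Icc,
      Set.inter_eq_left.2 (Set.Icc_subset_Icc ha hb), Real.volume_Icc]
  refine ⟨hprob, h, fun a b ha _ hb => ?_, fun a b ha _ hb => ?_⟩
  · rw [← hIcc a b ha hb, ← hfst, Measure.map_apply measurable_fst measurableSet_Icc]
    refine measure_inter_unitSquare h fun p hp => ?_
    simp [-Set.Icc_prod_Icc, hp.2.1, hp.2.2]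
  · rw [← hIcc a b ha hb, ← hsnd, Measure.map_apply measurable_snd measurableSet_Icc]
    refine measure_inter_unitSquare h fun p hp => ?_
    simp [-Set.Icc_prod_Icc, hp.1.1, hp.1.2]

theorem isPermuton_nu {α β : ℝ} (hα : 0 < α) (hβ : β ∈ Set.Icc (0 : ℝ) 1) :
    IsPermuton (nu α β) := by
  refine isPermuton_of_Iic (nu_compl_unitSquare hα hβ) (fun a ha => ?_) fun a ha => ?_
  · rw [nu_Iic_prod_Iic hα hβ ha (by simp), limitCDF_one_right hα hβ ha]
  · rw [nu_Iic_prod_Iic hα hβ (by simp) ha, limitCDF_one_left hα hβ ha]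

end Permuton

/-! ### Weak convergence from distribution functions -/

section WeakConvergence

theorem measureReal_Ioc_prod_Ioc (μ : Measure (ℝ × ℝ)) [IsFiniteMeasure μ] {a b c d : ℝ}
    (hab : a ≤ b) (hcd : c ≤ d) :
    μ.real (Set.Ioc a b ×ˢ Set.Ioc c d) = μ.real (Set.Iic b ×ˢ Set.Iic d) -
      μ.real (Set.Iic a ×ˢ Set.Iic d) -
        (μ.real (Set.Iic b ×ˢ Set.Iic c) - μ.real (Set.Iic a ×ˢ Set.Iic c)) := by
  have h1 : ∀ e, μ.real (Set.Ioc a b ×ˢ Set.Iic e) =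
      μ.real (Set.Iic b ×ˢ Set.Iic e) - μ.real (Set.Iic a ×ˢ Set.Iic e) := by
    intro e
    rw [← measureReal_sdiff (Set.prod_mono (Set.Iic_subset_Iic.2 hab) subset_rfl)
      (measurableSet_Iic.prod measurableSet_Iic)]
    congr 1
    ext p
    simp only [Set.mem_prod, Set.mem_Ioc, Set.mem_Iic, Set.mem_sdiff]
    rw [← not_le]
    tauto
  rw [← h1 d, ← h1 c, ← measureReal_sdiff (Set.prod_mono subset_rfl (Set.Iic_subset_Iic.2 hcd))
    (measurableSet_Ioc.prod measurableSet_Iic)]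
  congr 1
  ext p
  simp only [Set.mem_prod, Set.mem_Ioc, Set.mem_Iic, Set.mem_sdiff]
  rw [← not_le, ← not_le]
  tauto

/-- Half-open rectangles form a π-system containing a neighbourhood of each point inside any open
set, and inclusion-exclusion gives convergence of their masses. Concentration on the unit square
extends the hypothesis to all corners by clamping coordinates. -/
theorem tendsto_of_tendsto_Iic_prod_Iic {ι : Type*} {l : Filter ι} [l.IsCountablyGenerated]
    {μ : ι → ProbabilityMeasure (ℝ × ℝ)} {ν : ProbabilityMeasure (ℝ × ℝ)}
    (hμ : ∀ i, (μ i : Measure (ℝ × ℝ)) (Set.Icc (0 : ℝ) 1 ×ˢ Set.Icc (0 : ℝ) 1)ᶜ = 0)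
    (hν : (ν : Measure (ℝ × ℝ)) (Set.Icc (0 : ℝ) 1 ×ˢ Set.Icc (0 : ℝ) 1)ᶜ = 0)
    (h : ∀ x ∈ Set.Icc (0 : ℝ) 1, ∀ y ∈ Set.Icc (0 : ℝ) 1,
      Tendsto (fun i => (μ i : Measure (ℝ × ℝ)).real (Set.Iic x ×ˢ Set.Iic y)) l
        (𝓝 ((ν : Measure (ℝ × ℝ)).real (Set.Iic x ×ˢ Set.Iic y)))) :
    Tendsto μ l (𝓝 ν) := by
  have hall : ∀ x y : ℝ,
      Tendsto (fun i => (μ i : Measure (ℝ × ℝ)).real (Set.Iic x ×ˢ Set.Iic y)) l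
        (𝓝 ((ν : Measure (ℝ × ℝ)).real (Set.Iic x ×ˢ Set.Iic y))) := by
    intro x y
    by_cases hxy : 0 ≤ x ∧ 0 ≤ y
    · have e : ∀ ρ : Measure (ℝ × ℝ), ρ (Set.Icc (0 : ℝ) 1 ×ˢ Set.Icc (0 : ℝ) 1)ᶜ = 0 →
          ρ.real (Set.Iic x ×ˢ Set.Iic y) =
            ρ.real (Set.Iic (min x 1) ×ˢ Set.Iic (min y 1)) := by
        intro ρ hρ
        refine congrArg ENNReal.toReal (measure_inter_unitSquare hρ fun p hp => ?_)
        simp [-Set.Iic_prod_Iic, hp.1.2, hp.2.2]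
      rw [e _ hν]
      simp only [e _ (hμ _)]
      exact h _ ⟨le_min hxy.1 zero_le_one, min_le_right _ _⟩ _
        ⟨le_min hxy.2 zero_le_one, min_le_right _ _⟩
    · have e : ∀ ρ : Measure (ℝ × ℝ), ρ (Set.Icc (0 : ℝ) 1 ×ˢ Set.Icc (0 : ℝ) 1)ᶜ = 0 →
          ρ.real (Set.Iic x ×ˢ Set.Iic y) = 0 := by
        intro ρ hρ
        rw [← measureReal_empty (μ := ρ)]
        refine congrArg ENNReal.toReal (measure_inter_unitSquare hρ fun p hp => ?_)
        simp only [Set.mem_prod, Set.mem_Iic, Set.mem_empty_iff_false, iff_false]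
        exact fun h => hxy ⟨hp.1.1.trans h.1, hp.2.1.trans h.2⟩
      rw [e _ hν]
      simp only [e _ (hμ _)]
      exact tendsto_const_nhds
  refine IsPiSystem.tendsto_probabilityMeasure_of_tendsto_of_mem
    (S := {s | ∃ a b c d : ℝ, s = Set.Ioc a b ×ˢ Set.Ioc c d}) ?_ ?_ ?_ ?_
  · rintro _ ⟨a, b, c, d, rfl⟩ _ ⟨a', b', c', d', rfl⟩ -
    exact ⟨max a a', min b b', max c c', min d d', by
      rw [Set.prod_inter_prod, Set.Ioc_inter_Ioc, Set.Ioc_inter_Ioc]⟩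
  · rintro _ ⟨a, b, c, d, rfl⟩
    exact measurableSet_Ioc.prod measurableSet_Ioc
  · intro U hU p hp
    obtain ⟨ε, hε, hball⟩ := Metric.isOpen_iff.1 hU p hp
    refine ⟨_, ⟨p.1 - ε / 2, p.1 + ε / 2, p.2 - ε / 2, p.2 + ε / 2, rfl⟩, ?_, ?_⟩
    · exact prod_mem_nhds (Ioc_mem_nhds (by linarith) (by linarith))
        (Ioc_mem_nhds (by linarith) (by linarith))
    · refine Set.Subset.trans (fun q hq => ?_) hball
      obtain ⟨⟨h1, h2⟩, h3, h4⟩ := hq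
      rw [Metric.mem_ball, Prod.dist_eq, Real.dist_eq, Real.dist_eq, max_lt_iff, abs_lt, abs_lt]
      refine ⟨⟨?_, ?_⟩, ?_, ?_⟩ <;> linarith
  · rintro _ ⟨a, b, c, d, rfl⟩
    -- Reversed endpoints give an empty interval; rewriting it as `Set.Ioc a a` lets
    -- inclusion-exclusion cover that case as well.
    have hIoc : ∀ a b : ℝ, Set.Ioc a b = Set.Ioc a (max a b) := by
      intro a b
      rcases le_total a b with hab | hab
      · rw [max_eq_right hab]
      · rw [max_eq_left hab, Set.Ioc_self, Set.Ioc_eq_empty (not_lt.2 hab)]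
    rw [hIoc a b, hIoc c d, ← NNReal.tendsto_coe]
    have e : ∀ ρ : ProbabilityMeasure (ℝ × ℝ), ∀ s, ((ρ s : NNReal) : ℝ) =
        (ρ : Measure (ℝ × ℝ)).real s := fun _ _ => rfl
    simp only [e]
    rw [measureReal_Ioc_prod_Ioc _ (le_max_left _ _) (le_max_left _ _)]
    simp only [measureReal_Ioc_prod_Ioc _ (le_max_left a b) (le_max_left c d)]
    exact ((hall _ _).sub (hall _ _)).sub ((hall _ _).sub (hall _ _))

end WeakConvergence

/-! ### The distribution function of the permuton of a permutation -/

section PermMeasure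

variable (n : ℕ+) (u : Equiv.Perm (Fin n))

theorem permMeasure_apply {A : Set (ℝ × ℝ)} (hA : MeasurableSet A) :
    permMeasure u A = ∑ i : Fin n, (n : ℝ≥0∞) * volume (A ∩ plotSquare u i) := by
  simp only [permMeasure, Measure.coe_finsetSum, Finset.sum_apply, Measure.smul_apply,
    Measure.restrict_apply hA, smul_eq_mul]

theorem mul_volume_plotSquare (i : Fin n) :
    (n : ℝ≥0∞) * volume (plotSquare u i) = ENNReal.ofReal (1 / (n : ℕ)) := by
  have hn : (0 : ℝ) < (n : ℕ) := by exact_mod_cast n.pos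
  have h : ∀ a : ℝ, (a + 1) / (n : ℕ) - a / (n : ℕ) = 1 / (n : ℕ) := fun a => by ring
  rw [plotSquare, Measure.volume_eq_prod, Measure.prod_prod, Real.volume_Icc, Real.volume_Icc, h, h,
    ← ENNReal.ofReal_natCast, ← ENNReal.ofReal_mul (by positivity),
    ← ENNReal.ofReal_mul (by positivity)]
  congr 1
  field_simp

theorem permMeasure_compl_unitSquare :
    permMeasure u (Set.Icc (0 : ℝ) 1 ×ˢ Set.Icc (0 : ℝ) 1)ᶜ = 0 := by
  have hn : (0 : ℝ) < (n : ℕ) := by exact_mod_cast n.pos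
  have hsub : ∀ i : Fin n, Set.Icc ((i : ℕ) / (n : ℕ) : ℝ) (((i : ℕ) + 1) / (n : ℕ)) ⊆
      Set.Icc 0 1 := by
    intro i
    refine Set.Icc_subset_Icc (by positivity) ?_
    rw [div_le_one hn]
    exact_mod_cast i.2
  rw [permMeasure_apply n u (measurableSet_Icc.prod measurableSet_Icc).compl]
  refine Finset.sum_eq_zero fun i _ => ?_
  have : (Set.Icc (0 : ℝ) 1 ×ˢ Set.Icc (0 : ℝ) 1)ᶜ ∩ plotSquare u i = ∅ := by
    rw [← Set.disjoint_iff_inter_eq_empty]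
    exact Set.disjoint_compl_left_iff_subset.2 (Set.prod_mono (hsub i) (hsub (u i)))
  rw [this, measure_empty, mul_zero]

theorem sum_ite_cornerCount (m k : ℕ) :
    (∑ i : Fin n, if (i : ℕ) < k ∧ (u i : ℕ) < m then ENNReal.ofReal (1 / (n : ℕ)) else 0) =
      ENNReal.ofReal (cornerCount u m k / (n : ℕ)) := by
  rw [← Finset.sum_filter, Finset.sum_const, nsmul_eq_mul, ← ENNReal.ofReal_natCast,
    ← ENNReal.ofReal_mul (Nat.cast_nonneg _), mul_one_div]
  rfl

theorem cornerCount_div_le_permMeasure {x y : ℝ} (hx : 0 ≤ x) (hy : 0 ≤ y) :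
    ENNReal.ofReal (cornerCount u ⌊((n : ℕ) : ℝ) * y⌋₊ ⌊((n : ℕ) : ℝ) * x⌋₊ / (n : ℕ)) ≤
      permMeasure u (Set.Iic x ×ˢ Set.Iic y) := by
  have hn : (0 : ℝ) < (n : ℕ) := by exact_mod_cast n.pos
  rw [permMeasure_apply n u (measurableSet_Iic.prod measurableSet_Iic), ← sum_ite_cornerCount]
  refine Finset.sum_le_sum fun i _ => ?_
  split_ifs with h
  · rw [← mul_volume_plotSquare n u i, Set.inter_eq_right.2]
    have key : ∀ (z : ℝ) (j : ℕ), 0 ≤ z → j < ⌊((n : ℕ) : ℝ) * z⌋₊ →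
        ((j : ℝ) + 1) / (n : ℕ) ≤ z := by
      intro z j hz hj
      rw [div_le_iff₀ hn, mul_comm]
      refine le_trans ?_ (Nat.floor_le (mul_nonneg hn.le hz))
      exact_mod_cast hj
    exact Set.prod_mono (fun s hs => hs.2.trans (key x _ hx h.1))
      fun s hs => hs.2.trans (key y _ hy h.2)
  · exact zero_le

theorem permMeasure_le_cornerCount_div {x y : ℝ} :
    permMeasure u (Set.Iic x ×ˢ Set.Iic y) ≤ ENNReal.ofReal
      (cornerCount u (⌊((n : ℕ) : ℝ) * y⌋₊ + 1) (⌊((n : ℕ) : ℝ) * x⌋₊ + 1) / (n : ℕ)) := by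
  have hn : (0 : ℝ) < (n : ℕ) := by exact_mod_cast n.pos
  rw [permMeasure_apply n u (measurableSet_Iic.prod measurableSet_Iic), ← sum_ite_cornerCount]
  refine Finset.sum_le_sum fun i _ => ?_
  split_ifs with h
  · rw [← mul_volume_plotSquare n u i]
    gcongr
    exact Set.inter_subset_right
  · have key : ∀ (z s : ℝ) (j : ℕ), s ≤ z → (j : ℝ) / (n : ℕ) ≤ s →
        j < ⌊((n : ℕ) : ℝ) * z⌋₊ + 1 := by
      intro z s j hs hj
      refine Nat.lt_succ_of_le (Nat.le_floor ?_)
      rw [div_le_iff₀ hn] at hj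
      nlinarith
    have : Set.Iic x ×ˢ Set.Iic y ∩ plotSquare u i = ∅ := by
      rw [Set.eq_empty_iff_forall_notMem]
      rintro ⟨s, t⟩ ⟨⟨h1, h2⟩, h3, h4⟩
      exact h ⟨key x s _ h1 h3.1, key y t _ h2 h4.1⟩
    rw [this, measure_empty, mul_zero]

/-- Squares counted at the floor corner lie wholly in the quadrant, and those meeting it are counted
at the corner shifted by one in both directions. That shift adds at most two points, each of mass
1/n. -/
theorem permMeasure_real_mem {x y : ℝ} (hx : 0 ≤ x) (hy : 0 ≤ y) :
    (permMeasure u).real (Set.Iic x ×ˢ Set.Iic y) ∈ Set.Icc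
      ((cornerCount u ⌊((n : ℕ) : ℝ) * y⌋₊ ⌊((n : ℕ) : ℝ) * x⌋₊ : ℝ) / (n : ℕ))
      ((cornerCount u ⌊((n : ℕ) : ℝ) * y⌋₊ ⌊((n : ℕ) : ℝ) * x⌋₊ : ℝ) / (n : ℕ) + 2 / (n : ℕ)) := by
  have hprob := isProbabilityMeasure_permMeasure n u
  constructor
  · rw [Measure.real, ← ENNReal.ofReal_le_iff_le_toReal (measure_ne_top _ _)]
    exact cornerCount_div_le_permMeasure n u hx hy
  · refine ENNReal.toReal_le_of_le_ofReal (by positivity)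
      ((permMeasure_le_cornerCount_div n u).trans (ENNReal.ofReal_le_ofReal ?_))
    rw [← add_div]
    gcongr
    exact_mod_cast cornerCount_add_one_add_one_le u _ _

end PermMeasure

/-! ### The limit theorem -/

section Limit

variable {α β : ℝ}

/-- This is the deterministic core: any sequence with asymptotically uniform corner counts will do.
For each y the profile at level ⌊ny⌋ is an evolution, and its scaling limit is the distribution
function of ν. -/
theorem tendsto_permPermuton (hα : 0 < α) (hβ : β ∈ Set.Icc (0 : ℝ) 1)
    {w : ℕ+ → List ℕ} {E : ℕ+ → ℕ → Prop} {x : ℕ+ → ℕ → ℤ}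
    (hw : ∀ n : ℕ+, 2 ≤ n → IsCoxeterWord n (w n))
    (hE : ∀ n : ℕ+, 2 ≤ n → (w n).Pairwise (OrderedBy (E n)))
    (hpath : ∀ n : ℕ+, 2 ≤ n → IsPath n (E n) (x n))
    (hx : ∀ ε > 0, ∀ᶠ n : ℕ+ in atTop, ∀ j ≤ (n : ℕ), |(x n j : ℝ) - β * j| ≤ ε * n)
    {v : ∀ n : ℕ+, Equiv.Perm (Fin n)}
    (hv : ∀ ε > 0, ∀ᶠ n : ℕ+ in atTop, ∀ k ≤ (n : ℕ), ∀ m ≤ (n : ℕ),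
      |(cornerCount (v n) m k : ℝ) - k * (m / (n : ℕ))| ≤ ε * (n : ℕ))
    (hν : IsProbabilityMeasure (nu α β)) :
    Tendsto (fun n : ℕ+ => permPermuton n ((tauWord (w n))^[⌊α * (n : ℕ)⌋₊] (v n))) atTop
      (𝓝 (⟨nu α β, hν⟩ : ProbabilityMeasure (ℝ × ℝ))) := by
  have hinv : Tendsto (fun n : ℕ+ => 2 / ((n : ℕ) : ℝ)) atTop (𝓝 0) :=
    (tendsto_natCast_atTop_atTop.comp tendsto_PNat_val_atTop_atTop).const_div_atTop 2
  refine tendsto_of_tendsto_Iic_prod_Iic (fun n => permMeasure_compl_unitSquare n _)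
    (nu_compl_unitSquare hα hβ) fun z hz y hy => ?_
  have hm : ∀ n : ℕ+, ⌊((n : ℕ) : ℝ) * y⌋₊ ≤ (n : ℕ) := fun n =>
    Nat.floor_le_of_le (mul_le_of_le_one_right (Nat.cast_nonneg _) hy.2)
  have hlim : Tendsto (fun n : ℕ+ =>
      (profile ((tauWord (w n))^[⌊α * (n : ℕ)⌋₊] (v n)) ⌊((n : ℕ) : ℝ) * y⌋₊
        ⌊((n : ℕ) : ℝ) * z⌋₊ : ℝ) / (n : ℕ)) atTop (𝓝 (limitCDF α β z y)) := by
    refine tendsto_evolution (E := E) (x := x)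
      (h := fun n t => profile ((tauWord (w n))^[t] (v n)) ⌊((n : ℕ) : ℝ) * y⌋₊)
      hα hβ hz hy ?_ ?_ ?_ ?_ hx ?_
    · filter_upwards [eventually_ge_atTop 2] with n hn using hpath n hn
    · filter_upwards [eventually_ge_atTop 2] with n hn
      exact isEvolution_profile (v n) (hm n) (hw n hn) (hE n hn)
    · exact fun n t i => Int.natCast_nonneg _
    · intro n t i hi
      refine add_le_of_succ_le (fun k => ?_) hi
      have := cornerCount_succ_le ((tauWord (w n))^[t] (v n)) ⌊((n : ℕ) : ℝ) * y⌋₊ k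
      simp only [profile]
      omega
    · intro ε hε
      filter_upwards [hv (ε / 2) (by positivity), hinv.eventually_lt_const hε] with n hn hn2 j hj
      have hn0 : (0 : ℝ) < (n : ℕ) := by exact_mod_cast n.pos
      rw [div_lt_iff₀ hn0] at hn2
      have h1 := hn j hj _ (hm n)
      have hjn : (j : ℝ) / (n : ℕ) ≤ 1 := div_le_one_of_le₀ (by exact_mod_cast hj) hn0.le
      have hj0 : 0 ≤ (j : ℝ) / (n : ℕ) := by positivity
      have f1 := Nat.floor_le (mul_nonneg hn0.le hy.1)
      have f2 := Nat.lt_floor_add_one (((n : ℕ) : ℝ) * y)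
      -- Replacing ⌊ny⌋/n by y changes the expected count by at most 1, which `hn2` absorbs.
      have e : (j : ℝ) * (⌊((n : ℕ) : ℝ) * y⌋₊ / (n : ℕ)) - y * j =
          j / (n : ℕ) * (⌊((n : ℕ) : ℝ) * y⌋₊ - (n : ℕ) * y) := by
        field_simp
      simp only [profile, Function.iterate_zero, id, Int.cast_natCast]
      rw [abs_le] at h1 ⊢
      constructor <;> nlinarith
  have hlim' : Tendsto (fun n : ℕ+ =>
      (profile ((tauWord (w n))^[⌊α * (n : ℕ)⌋₊] (v n)) ⌊((n : ℕ) : ℝ) * y⌋₊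
        ⌊((n : ℕ) : ℝ) * z⌋₊ : ℝ) / (n : ℕ) + 2 / (n : ℕ)) atTop (𝓝 (limitCDF α β z y)) := by
    simpa using hlim.add hinv
  have hνr : (nu α β).real (Set.Iic z ×ˢ Set.Iic y) = limitCDF α β z y := by
    rw [Measure.real, nu_Iic_prod_Iic hα hβ hz hy]
    exact ENNReal.toReal_ofReal (le_max_left _ _)
  have hgoal : Tendsto (fun n : ℕ+ => (permMeasure ((tauWord (w n))^[⌊α * (n : ℕ)⌋₊] (v n))).real
      (Set.Iic z ×ˢ Set.Iic y)) atTop (𝓝 ((nu α β).real (Set.Iic z ×ˢ Set.Iic y))) := by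
    rw [hνr]
    exact tendsto_of_tendsto_of_tendsto_of_le_of_le hlim hlim'
      (fun n => (permMeasure_real_mem n _ hz.1 hy.1).1)
      fun n => (permMeasure_real_mem n _ hz.1 hy.1).2
  exact hgoal

end Limit

end BubbleSort

/-- For every `α > 0` and `β ∈ [0,1]`, the measure `ν^{α,β}` is a permuton. Let the permutations
`v_n`, `n ≥ 1`, be defined on one probability space, each of them uniform. If the Coxeter words
`c_n` correspond to lattice paths whose functions `θ` converge pointwise to `z ↦ β z`, then almost
surely the permutons of `τ_{c_n}^⌊αn⌋(v_n)` converge weakly to `ν^{α,β}`. In particular, for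
`β = 1` this holds for the bubble-sort words `(1, 2, …, n - 1)`. -/
theorem theorem1p4 (α β : ℝ) (hα : 0 < α) (hβ : β ∈ Set.Icc (0 : ℝ) 1)
    {Ω : Type*} [MeasurableSpace Ω] (P : Measure Ω) [IsProbabilityMeasure P]
    (v : ∀ n : ℕ+, Ω → Equiv.Perm (Fin n))
    (hv : ∀ n : ℕ+, BubbleSort.IsUniformPerm P (v n)) :
    ∃ hν : BubbleSort.IsPermuton (BubbleSort.nu α β),
      (∀ (c : ℕ+ → List ℕ) (L : ∀ n : ℕ+, BubbleSort.LatticePath n),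
        (∀ n : ℕ+, 2 ≤ n → BubbleSort.Corresponds (c n) (L n)) →
        (∀ z ∈ Set.Icc (0 : ℝ) 1,
          Tendsto (fun n : ℕ+ => (L n).theta z) atTop (𝓝 (β * z))) →
        ∀ᵐ ω ∂P, Tendsto
          (fun n : ℕ+ => BubbleSort.permPermuton n
            ((BubbleSort.tauWord (c n))^[⌊α * (n : ℕ)⌋₊] (v n ω)))
          atTop (𝓝 (⟨BubbleSort.nu α β, hν.isProbabilityMeasure⟩ : ProbabilityMeasure (ℝ × ℝ))))
      ∧ (β = 1 → ∀ᵐ ω ∂P, Tendsto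
          (fun n : ℕ+ => BubbleSort.permPermuton n
            ((BubbleSort.tauWord (List.range' 1 ((n : ℕ) - 1)))^[⌊α * (n : ℕ)⌋₊] (v n ω)))
          atTop (𝓝 (⟨BubbleSort.nu α β, hν.isProbabilityMeasure⟩ : ProbabilityMeasure (ℝ × ℝ)))) := by
  have hae := BubbleSort.ae_eventually_cornerCount hv
  refine ⟨BubbleSort.isPermuton_nu hα hβ, fun c L hc hθ => ?_, fun hβ1 => ?_⟩
  · filter_upwards [hae] with ω hω
    exact BubbleSort.tendsto_permPermuton hα hβ (fun n hn => (hc n hn).coxeter)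
      (fun n hn => (hc n hn).pairwise_orderedBy) (fun n hn => (L n).isPath (hc n hn).start_eq)
      (fun ε hε => BubbleSort.eventually_xCoord_sub_le hβ (fun n hn => (hc n hn).start_eq) hθ hε)
      hω _
  · filter_upwards [hae] with ω hω
    refine BubbleSort.tendsto_permPermuton hα hβ (fun n _ => BubbleSort.isCoxeterWord_range' n)
      (fun n _ => BubbleSort.pairwise_orderedBy_range' _)
      (fun n _ => BubbleSort.isPath_natCast n) (fun ε hε => ?_) hω _
    refine Eventually.of_forall fun n j _ => ?_
    have : (0 : ℝ) ≤ ε * (n : ℕ) := by positivity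
    simpa [hβ1] using this
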